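/- **Setting.** Consider $M$ subsystems $i\in\mathcal M=\{1,\dots,M\}$ with states $x_i\in\mathbb R^{n_i}$, inputs $u_i\in\mathbb R^{m_i}$ and neighbourhoods $\mathcal N_i\subseteq\mathcal M\setminus\{i\}$ (the subsystems that affect $i$). For each $i$, the state constraint set $\mathcal X_i$ is convex and is the union of finitely many closed convex polyhedra $P_i^{(l)}$, $l\in\mathcal L_i$ (the regions), with pairwise disjoint interiors; $\mathcal U_i$ is closed and convex. The dynamics are $x_i^+=f_i(x_i,u_i,\{x_j\}_{j\in\mathcal N_i})$, where $f_i$ is a function satisfying $f_i=f_i^{(l)}$ whenever $x_i\in P_i^{(l)}$, for every $l$, with $$f_i^{(l)}(x_i,u_i,\{x_j\})=A_i^{(l)}x_i+B_i^{(l)}u_i+c_i^{(l)}+\sum_{j\in\mathcal N_i}A_{ij}^{(l)}x_j$$ (so the affine pieces agree where regions meet). Let $h_i(x_i,\{x_j\}_{j\in\mathcal N_i})\le 0$ be finitely many affine coupled constraints. **MPC problem.** Fix a horizon $N\ge1$, gains $K_i^{(l)}$, terminal sets $\mathcal X_{T,i}\subseteq\mathbb R^{n_i}$, and costs $\ell_i=x_i^\top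 Q_ix_i+u_i^\top R_iu_i+\sum_{j\in\mathcal N_i}x_j^\top Q_{ij}x_j$, $V_{f,i}=x_i^\top\Phi_ix_i$; put $\mathcal X_T=\prod_i\mathcal X_{T,i}$. A local variable $\mathbf y_i=(\tilde{\mathbf x}_i,\mathbf u_i)$ consists of $\tilde{\mathbf x}_i=(\mathbf x_i,(\mathbf x_j^{(i)})_{j\in\mathcal N_i})$, i.e. a predicted state trajectory $\mathbf x_i=(x_i(0),\dots,x_i(N))$ and copies $\mathbf x_j^{(i)}$ of the neighbours' trajectories, and of inputs $\mathbf u_i=(u_i(0),\dots,u_i(N-1))$. Its cost is $$F_i(\mathbf y_i)=\sum_{k<N}\ell_i(x_i(k),u_i(k),\{x_j^{(i)}(k)\})+V_{f,i}(x_i(N)).$$ Let $\mathcal Y_i(x_i)$ be the set of $\mathbf y_i$ with $x_i(0)=x_i$, $h_i(x_i(k),\{x_j^{(i)}(k)\})\le0$ and $x_i(k)\in\mathcal X_i$ for $0\le k\le N$, $u_i(k)\in\mathcal U_i$ for $0\le k<N$, and $x_i(N)\in\mathcal X_{T,i}$. For a switching sequence $s_i\in\mathcal L_i^{N+1}$ let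 $\mathcal Y_i^{(s_i)}$ be the set of $\mathbf y_i$ with $x_i(k)\in P_i^{(s_i(k))}$ for $0\le k\le N$ and $x_i(k+1)=f_i^{(s_i(k))}(x_i(k),u_i(k),\{x_j^{(i)}(k)\})$ for $0\le k<N$. Let $\mathcal Y(x)$ be the set of $\mathbf y=(\mathbf y_i)_i$ with $\mathbf y_i\in\mathcal Y_i(x_i)$, $x_i(k+1)=f_i(x_i(k),u_i(k),\{x^{(i)}_j(k)\})$ and $\mathbf x_j^{(i)}=\mathbf x_j$ for all $i$ and $j\in\mathcal N_i$; for $s=(s_1,\dots,s_M)$ let $\mathcal Y_s(x)$ be the set of $\mathbf y$ with $\mathbf y_i\in\mathcal Y_i(x_i)\cap\mathcal Y_i^{(s_i)}$ and $\mathbf x_j^{(i)}=\mathbf x_j$ for all $i$ and $j\in\mathcal N_i$. Put $\mathcal X_0=\{x:\mathcal Y(x)\ne\emptyset\}$. **Switching ADMM.** The *roll-out* $\mathbf y_{\mathrm{dr}}$ of input sequences $\hat{\mathbf u}$ from $x$ consists of $\hat{\mathbf u}$, the state trajectories that it produces under the true dynamics, and exact copies of these. Given $x_i$, the inputs and copies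 in $\mathbf y_i$ *generate* $s_i$ if the trajectory $\xi(0)=x_i$, $\xi(k+1)=f_i^{(s_i(k))}(\xi(k),u_i(k),\{x_j^{(i)}(k)\})$ satisfies $\xi(k)\in\overline{P}{}_i^{(s_i(k))}$ for $0\le k\le N$. The sequences $\hat{\mathbf u}$ are *weakly feasible* for $x$ if their roll-out generates at least one global sequence $s$ and $\mathcal Y_s(x)\neq\emptyset$ for every $s$ it generates. With $\rho>0$ and $T_{\rm cut}\in\mathbb N$, switching ADMM at $x$ with guess $\hat{\mathbf u}$ starts from $\mathbf z=0$, $\boldsymbol\lambda=0$ and any $s$ generated by the roll-out, and repeats for $\tau=0,1,\dots$ and all $i$: (i) $\mathbf y_i$ becomes a minimizer of $F_i(\mathbf y_i)+\boldsymbol\lambda_i^\top\tilde{\mathbf x}_i+\frac\rho2\|\tilde{\mathbf x}_i-\tilde{\mathbf z}_i\|_2^2$ over $\mathcal Y_i(x_i)\cap\mathcal Y_i^{(s_i)}$, where $\tilde{\mathbf z}_i=(\mathbf z_i,(\mathbf z_j)_{j\in\mathcal N_i})$; (ii) $\mathbf z_i$ becomes the average of $\mathbf x_i$ and all copies $\mathbf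 x_i^{(j)}$, $i\in\mathcal N_j$; (iii) $\boldsymbol\lambda_i$ increases by $\rho(\tilde{\mathbf x}_i-\tilde{\mathbf z}_i)$; (iv) if $\tau<T_{\rm cut}$ and $\mathbf y_i$ generates a sequence other than $s_i$, then $s_i$ is replaced by such a sequence. The output is the limit of $\mathbf y$ as the number of iterations tends to infinity. **Controller.** At each time step with state $x$: if $x\in\mathcal X_T$, apply $u_i=K_i^{(l)}x_i$ with some $l$ such that $x_i\in P_i^{(l)}$. Otherwise take a guess $\hat{\mathbf u}$: a given one at the first time step, and afterwards $\hat{\mathbf u}_i=(\bar u_i(1),\dots,\bar u_i(N-1),K_i^{(l)}\bar x_i(N))$ with $\bar x_i(N)\in P_i^{(l)}$, where $\bar{\mathbf x},\bar{\mathbf u}$ is the previous plan. Run switching ADMM; its output is the plan $\mathbf y$, except that if the roll-out satisfies $\mathbf y_{\mathrm{dr}}\in\mathcal Y(x)$ and $F_i(\mathbf y_i)\le F_i(\mathbf y_{i,\mathrm{dr}})$ fails for some $i$, then the plan is $\mathbf y_{\mathrm{dr}}$. Apply the first inputs $u_i(0)$ of the plan. **Assumptions.** 1. For every $x\in\mathcal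 X_0$ there is no $s$ with $\mathcal Y_s(x)=\emptyset$ and $\mathcal Y_i(x_i)\cap\mathcal Y_i^{(s_i)}\ne\emptyset$ for all $i$. 2. The number of ADMM iterations tends to infinity (the output is the limit, as above). 3. All pairs $(A_i^{(l)},B_i^{(l)})$ are controllable, all $A_i^{(l)}+B_i^{(l)}K_i^{(l)}$ are Schur, and $c_i^{(l)}=0$ for all $l\in\hat{\mathcal L}_i:=\{l:0\in\overline{P}{}_i^{(l)}\}$. 4. $\mathcal X_{T,i}\subseteq\bigcup_{l\in\hat{\mathcal L}_i}P_i^{(l)}$ is closed and contains a neighbourhood of $0$ relative to $\mathcal X_i$. For all $x_i\in\mathcal X_{T,i}\cap P_i^{(l)}$ we have $K_i^{(l)}x_i\in\mathcal U_i$, and $f_i(x_i,K_i^{(l)}x_i,\{x_j\})\in\mathcal X_{T,i}$ whenever $x_j\in\mathcal X_{T,j}$ for all $j\in\mathcal N_i$. If $x\in\mathcal X_T$ satisfies the coupled constraints, so does its successor under $u_i=K_i^{(l_i)}x_i$, for all $l_i$ with $x_i\in P_i^{(l_i)}$. 5. $Q_i,R_i,\Phi_i$ are positive definite, $Q_{ij}$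 is positive semidefinite, and for all $x\in\mathcal X_T$ and all $l_i$ with $x_i\in P_i^{(l_i)}$, with $u_i=K_i^{(l_i)}x_i$, $$\sum_{i\in\mathcal M}\Big(V_{f,i}\big(f_i(x_i,u_i,\{x_j\})\big)-V_{f,i}(x_i)+\ell_i(x_i,u_i,\{x_j\})\Big)\le0.$$ 6. For an initial state outside $\mathcal X_T$, the given first guess is weakly feasible. **Theorem.** Under Assumptions 1–6 the controller is exponentially stabilizing with region of attraction $\mathcal X_0$: there is $\gamma\in(0,1)$ such that * there are $\delta>0$ and $C$ with $\|x(t)\|\le C\gamma^t\|x(0)\|$ for all $t\ge0$ and all closed-loop trajectories with $x(0)\in\mathcal X_0$, $\|x(0)\|<\delta$; * for every closed-loop trajectory with $x(0)\in\mathcal X_0$ there is $C$ with $\|x(t)\|\le C\gamma^t\|x(0)\|$ for all $t\ge0$; * if all $\mathcal X_i$ and $\mathcal U_i$ are bounded, one constant $C$ serves all closed-loop trajectories with $x(0)\in\mathcal X_0$. Moreover, if all $\mathcal U_i$ and $\mathcal X_{T,i}$ are polyhedra, the control law is well defined: from every initial state in $\mathcal X_0$ the closed loop never gets stuck, and every execution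 of switching ADMM that occurs in it converges. -/

import Mathlib

open Filter Topology Matrix

noncomputable section

/-- A (closed, possibly unbounded) polyhedron: finitely many affine inequalities `G x ≤ g`. -/
def IsPolyhedron {n : ℕ} (T : Set (Fin n → ℝ)) : Prop :=
  ∃ (q : ℕ) (G : Matrix (Fin q) (Fin n) ℝ) (g : Fin q → ℝ), T = {x | G *ᵥ x ≤ g}

/-- A matrix pair is controllable: the columns of `B, A B, …, A^(n-1) B` span the state space. -/
def IsControllablePair {n m : ℕ} (A : Matrix (Fin n) (Fin n) ℝ) (B : Matrix (Fin n) (Fin m) ℝ) :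
    Prop :=
  Submodule.span ℝ {v : Fin n → ℝ | ∃ k < n, ∃ w : Fin m → ℝ, v = (A ^ k * B) *ᵥ w} = ⊤

/-- A real square matrix is Schur: all its complex eigenvalues lie in the open unit disc. -/
def IsSchur {n : ℕ} (A : Matrix (Fin n) (Fin n) ℝ) : Prop :=
  ∀ μ ∈ spectrum ℂ (A.map (algebraMap ℝ ℂ)), ‖μ‖ < 1

/-- A network of `M` coupled piecewise affine (PWA) subsystems with constraints. -/
structure PWANetwork (M : ℕ) where
  /-- state dimensions -/
  n : Fin M → ℕ
  /-- input dimensions -/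
  m : Fin M → ℕ
  /-- `nbr i` is the neighbourhood of `i`: the subsystems that affect `i` -/
  nbr : Fin M → Finset (Fin M)
  not_mem_nbr : ∀ i, i ∉ nbr i
  /-- numbers of PWA regions -/
  L : Fin M → ℕ
  /-- PWA regions -/
  P : ∀ i, Fin (L i) → Set (Fin (n i) → ℝ)
  isPolyhedron_P : ∀ i l, IsPolyhedron (P i l)
  disjoint_interior : ∀ i l l', l ≠ l' → Disjoint (interior (P i l)) (interior (P i l'))
  /-- state constraint sets -/
  X : ∀ i, Set (Fin (n i) → ℝ)
  convex_X : ∀ i, Convex ℝ (X i)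
  iUnion_P : ∀ i, ⋃ l, P i l = X i
  /-- input constraint sets -/
  U : ∀ i, Set (Fin (m i) → ℝ)
  convex_U : ∀ i, Convex ℝ (U i)
  isClosed_U : ∀ i, IsClosed (U i)
  A : ∀ i, Fin (L i) → Matrix (Fin (n i)) (Fin (n i)) ℝ
  B : ∀ i, Fin (L i) → Matrix (Fin (n i)) (Fin (m i)) ℝ
  c : ∀ i, Fin (L i) → (Fin (n i) → ℝ)
  /-- coupling matrices `A_ij`, for `j` in the neighbourhood of `i` -/
  Ac : ∀ i, Fin (L i) → ∀ j : nbr i, Matrix (Fin (n i)) (Fin (n j)) ℝ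
  /-- the state update functions; their values outside the state constraint set are arbitrary -/
  f : ∀ i, (Fin (n i) → ℝ) → (Fin (m i) → ℝ) → (∀ j : nbr i, Fin (n j) → ℝ) → (Fin (n i) → ℝ)
  f_eq : ∀ i l x u xn, x ∈ P i l →
    f i x u xn = A i l *ᵥ x + B i l *ᵥ u + c i l + ∑ j, Ac i l j *ᵥ xn j
  /-- numbers of scalar coupled constraints -/
  p : Fin M → ℕ
  /-- coefficients of the coupled constraints `H_i x_i + ∑ j, H_ij x_j + h0_i ≤ 0` -/
  H : ∀ i, Matrix (Fin (p i)) (Fin (n i)) ℝ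
  Hc : ∀ i, ∀ j : nbr i, Matrix (Fin (p i)) (Fin (n j)) ℝ
  h0 : ∀ i, Fin (p i) → ℝ

namespace PWANetwork

variable {M : ℕ} (S : PWANetwork M)

/-- Local states, local inputs, global states and global inputs. -/
abbrev St (i : Fin M) : Type := Fin (S.n i) → ℝ
abbrev Inp (i : Fin M) : Type := Fin (S.m i) → ℝ
abbrev State : Type := ∀ i, S.St i
abbrev Input : Type := ∀ i, S.Inp i

/-- The affine dynamics `f_i^(l)` of region `l`, used also outside that region. -/
def aff (i : Fin M) (l : Fin (S.L i)) (x : S.St i) (u : S.Inp i) (xn : ∀ j : S.nbr i, S.St j) :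
    S.St i :=
  S.A i l *ᵥ x + S.B i l *ᵥ u + S.c i l + ∑ j, S.Ac i l j *ᵥ xn j

/-- The coupled constraint functions `h_i`. -/
def h (i : Fin M) (x : S.St i) (xn : ∀ j : S.nbr i, S.St j) : Fin (S.p i) → ℝ :=
  S.H i *ᵥ x + ∑ j, S.Hc i j *ᵥ xn j + S.h0 i

/-- The states of the neighbours of `i` in a global state. -/
def nbrState (x : S.State) (i : Fin M) : ∀ j : S.nbr i, S.St j := fun j => x j

/-- One step of the true network dynamics. -/
def next (x : S.State) (u : S.Input) : S.State := fun i => S.f i (x i) (u i) (S.nbrState x i)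

end PWANetwork

/-- The design data of the distributed MPC controller for the network `S`. -/
structure MPCDesign {M : ℕ} (S : PWANetwork M) where
  /-- prediction horizon -/
  N : ℕ
  N_pos : 0 < N
  /-- weights of the stage and terminal costs -/
  Q : ∀ i, Matrix (Fin (S.n i)) (Fin (S.n i)) ℝ
  R : ∀ i, Matrix (Fin (S.m i)) (Fin (S.m i)) ℝ
  Qc : ∀ i, ∀ j : S.nbr i, Matrix (Fin (S.n j)) (Fin (S.n j)) ℝ
  Φ : ∀ i, Matrix (Fin (S.n i)) (Fin (S.n i)) ℝ
  /-- gains of the terminal controllers -/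
  K : ∀ i, Fin (S.L i) → Matrix (Fin (S.m i)) (Fin (S.n i)) ℝ
  /-- local terminal sets -/
  XT : ∀ i, Set (S.St i)
  /-- ADMM penalty parameter -/
  ρ : ℝ
  ρ_pos : 0 < ρ
  /-- number of ADMM iterations after which the switching sequences are frozen -/
  Tcut : ℕ

namespace MPCDesign

variable {M : ℕ} {S : PWANetwork M} (D : MPCDesign S)

/-! ### Costs and predicted trajectories -/

/-- Stage cost. -/
def stage (i : Fin M) (x : S.St i) (u : S.Inp i) (xn : ∀ j : S.nbr i, S.St j) : ℝ :=
  x ⬝ᵥ D.Q i *ᵥ x + u ⬝ᵥ D.R i *ᵥ u + ∑ j, xn j ⬝ᵥ D.Qc i j *ᵥ xn j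

/-- Terminal cost. -/
def Vf (i : Fin M) (x : S.St i) : ℝ := x ⬝ᵥ D.Φ i *ᵥ x

/-- Local state trajectories over the horizon, local input sequences, augmented trajectories
(own trajectory and copies of the trajectories of the neighbours), local decision variables
`y_i`, and global decision variables `y`. -/
abbrev Traj (i : Fin M) : Type := Fin (D.N + 1) → S.St i
abbrev InpSeq (i : Fin M) : Type := Fin D.N → S.Inp i
abbrev Aug (i : Fin M) : Type := D.Traj i × (∀ j : S.nbr i, D.Traj j)
abbrev LocVar (i : Fin M) : Type := D.Aug i × D.InpSeq i
abbrev Var : Type := ∀ i, D.LocVar i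

/-- Local switching sequences. -/
abbrev SwSeq (i : Fin M) : Type := Fin (D.N + 1) → Fin (S.L i)

variable {D}

/-- Own state trajectory `x_i` in a local decision variable. -/
def LocVar.own {i : Fin M} (y : D.LocVar i) : D.Traj i := y.1.1

/-- Local copy `x_j^(i)` of the trajectory of the neighbour `j`. -/
def LocVar.copy {i : Fin M} (y : D.LocVar i) (j : S.nbr i) : D.Traj j := y.1.2 j

/-- Input sequence `u_i` in a local decision variable. -/
def LocVar.inp {i : Fin M} (y : D.LocVar i) : D.InpSeq i := y.2

variable (D)

/-- Local cost `F_i` over the horizon. -/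
def cost (i : Fin M) (y : D.LocVar i) : ℝ :=
  ∑ k : Fin D.N,
    D.stage i (LocVar.own y k.castSucc) (LocVar.inp y k) (fun j => LocVar.copy y j k.castSucc)
  + D.Vf i (LocVar.own y (Fin.last D.N))

/-! ### Feasible sets -/

/-- Local constraints independent of the switching sequence, with the terminal constraint. -/
def localSet (i : Fin M) (xi : S.St i) : Set (D.LocVar i) :=
  {y | (∀ k, S.h i (LocVar.own y k) (fun j => LocVar.copy y j k) ≤ 0) ∧
    (∀ k, LocVar.own y k ∈ S.X i) ∧ (∀ k, LocVar.inp y k ∈ S.U i) ∧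
    LocVar.own y 0 = xi ∧ LocVar.own y (Fin.last D.N) ∈ D.XT i}

/-- Local constraints imposed by the switching sequence `s_i`. -/
def switchSet (i : Fin M) (s : D.SwSeq i) : Set (D.LocVar i) :=
  {y | (∀ k : Fin D.N, LocVar.own y k.succ =
      S.aff i (s k.castSucc) (LocVar.own y k.castSucc) (LocVar.inp y k)
        (fun j => LocVar.copy y j k.castSucc)) ∧
    ∀ k, LocVar.own y k ∈ S.P i (s k)}

/-- All local copies agree with the trajectories they copy. -/
def Consistent (y : D.Var) : Prop :=
  ∀ i, ∀ j : S.nbr i, LocVar.copy (y i) j = LocVar.own (y j)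

/-- The feasible set `Y(x)` of the distributed MPC problem. -/
def feasible (x : S.State) : Set D.Var :=
  {y | (∀ i, y i ∈ D.localSet i (x i)) ∧
    (∀ i, ∀ k : Fin D.N, LocVar.own (y i) k.succ =
      S.f i (LocVar.own (y i) k.castSucc) (LocVar.inp (y i) k)
        (fun j => LocVar.copy (y i) j k.castSucc)) ∧
    D.Consistent y}

/-- The feasible set `Y_s(x)` for the global switching sequence `s`. -/
def feasibleSw (s : ∀ i, D.SwSeq i) (x : S.State) : Set D.Var :=
  {y | (∀ i, y i ∈ D.localSet i (x i) ∩ D.switchSet i (s i)) ∧ D.Consistent y}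

/-- The set `X_0` of states for which the MPC problem is feasible. -/
def X0 : Set S.State := {x | (D.feasible x).Nonempty}

/-- The global terminal set. -/
def XTglobal : Set S.State := {x | ∀ i, x i ∈ D.XT i}

/-! ### Roll-out, generated switching sequences, weak feasibility -/

/-- Predicted states under the true dynamics and the input sequences `u`
(the zero input after the horizon is never used). -/
def roll (x : S.State) (u : ∀ i, D.InpSeq i) : ℕ → S.State
  | 0 => x
  | k + 1 => S.next (roll x u k) (fun i => if hk : k < D.N then u i ⟨k, hk⟩ else 0)

/-- Distributed roll-out of the dynamics from `x` under `u`. -/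
def rollout (x : S.State) (u : ∀ i, D.InpSeq i) : D.Var :=
  fun i => ((fun k => D.roll x u k i, fun j k => D.roll x u k j), u i)

/-- The switching sequences generated by the initial state, inputs and copies in `y`: roll out the
local dynamics, branching over all regions whose closure contains the current state. -/
def evalSwitching (i : Fin M) (xi : S.St i) (y : D.LocVar i) : Set (D.SwSeq i) :=
  {s | ∃ ξ : D.Traj i, ξ 0 = xi ∧ (∀ k, ξ k ∈ closure (S.P i (s k))) ∧
    ∀ k : Fin D.N, ξ k.succ =
      S.aff i (s k.castSucc) (ξ k.castSucc) (LocVar.inp y k)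
        (fun j => LocVar.copy y j k.castSucc)}

/-- The input sequences `u` are weakly feasible at `x`: they generate a global switching sequence,
and every one that they generate has a nonempty feasible set. -/
def WeaklyFeasible (x : S.State) (u : ∀ i, D.InpSeq i) : Prop :=
  (∃ s : ∀ i, D.SwSeq i, ∀ i, s i ∈ D.evalSwitching i (x i) (D.rollout x u i)) ∧
  ∀ s : ∀ i, D.SwSeq i, (∀ i, s i ∈ D.evalSwitching i (x i) (D.rollout x u i)) →
    (D.feasibleSw s x).Nonempty

/-! ### Switching ADMM -/

/-- Euclidean inner product of augmented trajectories. -/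
def augDot {i : Fin M} (a b : D.Aug i) : ℝ :=
  ∑ k, a.1 k ⬝ᵥ b.1 k + ∑ j, ∑ k, a.2 j k ⬝ᵥ b.2 j k

/-- The components of the consensus variable `z` that are relevant to subsystem `i`. -/
def augOf (z : ∀ i, D.Traj i) (i : Fin M) : D.Aug i := (z i, fun j => z j)

/-- Objective of the local minimization. -/
def localObj (i : Fin M) (lam : D.Aug i) (z : ∀ i, D.Traj i) (y : D.LocVar i) : ℝ :=
  D.cost i y + D.augDot lam y.1 + D.ρ / 2 * D.augDot (y.1 - D.augOf z i) (y.1 - D.augOf z i)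

/-- Average of the trajectory of `i` and of all copies of it held by other subsystems. -/
def average (y : D.Var) (i : Fin M) : D.Traj i :=
  ((Fintype.card {j // i ∈ S.nbr j} : ℝ) + 1)⁻¹ •
    (LocVar.own (y i) + ∑ j : {j // i ∈ S.nbr j}, LocVar.copy (y j) ⟨i, j.2⟩)

/-- A (never-ending) execution of the switching ADMM procedure at state `x` with initial guess `u`.
Here `s τ`, `z τ`, `lam τ` are the iterates at the beginning of iteration `τ`, and `y τ` is the
solution of the local minimizations in iteration `τ`. -/
structure IsSwADMM (x : S.State) (u : ∀ i, D.InpSeq i) (s : ℕ → ∀ i, D.SwSeq i) (y : ℕ → D.Var)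
    (z : ℕ → ∀ i, D.Traj i) (lam : ℕ → ∀ i, D.Aug i) : Prop where
  z_zero : z 0 = 0
  lam_zero : lam 0 = 0
  s_zero : ∀ i, s 0 i ∈ D.evalSwitching i (x i) (D.rollout x u i)
  y_mem : ∀ τ i, y τ i ∈ D.localSet i (x i) ∩ D.switchSet i (s τ i)
  y_min : ∀ τ i, IsMinOn (D.localObj i (lam τ i) (z τ))
    (D.localSet i (x i) ∩ D.switchSet i (s τ i)) (y τ i)
  z_succ : ∀ τ i, z (τ + 1) i = D.average (y τ) i
  lam_succ : ∀ τ i, lam (τ + 1) i = lam τ i + D.ρ • ((y τ i).1 - D.augOf (z (τ + 1)) i)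
  s_switch : ∀ τ < D.Tcut, ∀ i, (D.evalSwitching i (x i) (y τ i) \ {s τ i}).Nonempty →
    s (τ + 1) i ∈ D.evalSwitching i (x i) (y τ i) \ {s τ i}
  s_keep : ∀ τ < D.Tcut, ∀ i, ¬ (D.evalSwitching i (x i) (y τ i) \ {s τ i}).Nonempty →
    s (τ + 1) i = s τ i
  s_frozen : ∀ τ, D.Tcut ≤ τ → s (τ + 1) = s τ

/-- `y'` is an output of switching ADMM as the number of iterations tends to infinity. -/
def IsSwADMMOutput (x : S.State) (u : ∀ i, D.InpSeq i) (y' : D.Var) : Prop :=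
  ∃ s y z lam, D.IsSwADMM x u s y z lam ∧ Tendsto y atTop (𝓝 y')

/-! ### The stabilizing distributed MPC algorithm -/

open Classical in
/-- `y` is a plan computed at `x` from the initial guess `u`: the output of switching ADMM, unless
the roll-out of the guess is feasible (has finite value) and the local cost of the output exceeds
that of the roll-out for some subsystem; in that case the roll-out is kept. -/
def IsPlan (x : S.State) (u : ∀ i, D.InpSeq i) (y : D.Var) : Prop :=
  ∃ y', D.IsSwADMMOutput x u y' ∧
    y = if D.rollout x u ∈ D.feasible x ∧ ¬ ∀ i, D.cost i (y' i) ≤ D.cost i (D.rollout x u i)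
      then D.rollout x u else y'

/-- The guess obtained by shifting the inputs of the previous plan and appending the terminal
controller. -/
def IsShiftedGuess (ybar : D.Var) (u : ∀ i, D.InpSeq i) : Prop :=
  ∀ i, ∃ l, LocVar.own (ybar i) (Fin.last D.N) ∈ S.P i l ∧
    u i = fun k : Fin D.N => if hk : (k : ℕ) + 1 < D.N then LocVar.inp (ybar i) ⟨k + 1, hk⟩
      else D.K i l *ᵥ LocVar.own (ybar i) (Fin.last D.N)

/-- The initial guess available to the controller: the given guess `u0` at the first time step
(no previous plan), the shifted previous plan afterwards. -/
def IsGuess (u0 : ∀ i, D.InpSeq i) (mem : Option D.Var) (u : ∀ i, D.InpSeq i) : Prop :=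
  match mem with
  | none => u = u0
  | some ybar => D.IsShiftedGuess ybar u

/-- State of the closed loop: network state and stored previous plan. -/
abbrev LoopState : Type := S.State × Option D.Var

/-- One time step of the closed loop. The first alternative is the terminal mode, the second the
MPC mode. -/
def Step (u0 : ∀ i, D.InpSeq i) (σ σ' : D.LoopState) : Prop :=
  (σ.1 ∈ D.XTglobal ∧ σ'.2 = σ.2 ∧ ∃ l : ∀ i, Fin (S.L i), (∀ i, σ.1 i ∈ S.P i (l i)) ∧
    σ'.1 = S.next σ.1 (fun i => D.K i (l i) *ᵥ σ.1 i)) ∨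
  (σ.1 ∉ D.XTglobal ∧ ∃ u y, D.IsGuess u0 σ.2 u ∧ D.IsPlan σ.1 u y ∧ σ'.2 = some y ∧
    σ'.1 = S.next σ.1 (fun i => LocVar.inp (y i) ⟨0, D.N_pos⟩))

/-- `σ` is a closed-loop trajectory from the initial state `x0` with first guess `u0`. -/
def IsClosedLoop (x0 : S.State) (u0 : ∀ i, D.InpSeq i) (σ : ℕ → D.LoopState) : Prop :=
  σ 0 = (x0, none) ∧ ∀ t, D.Step u0 (σ t) (σ (t + 1))

/-- Admissible initial data: a feasible initial state with, unless it lies in the terminal set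
already, a weakly feasible first guess. -/
def IsInitial (x0 : S.State) (u0 : ∀ i, D.InpSeq i) : Prop :=
  x0 ∈ D.X0 ∧ (x0 ∉ D.XTglobal → D.WeaklyFeasible x0 u0)

/-! ### Assumptions -/

/-- Coupling: at states in `X_0`, if all local problems for `s` are feasible, so is the global
problem for `s`. -/
def CouplingAssumption : Prop :=
  ∀ x ∈ D.X0, ¬ ∃ s : ∀ i, D.SwSeq i, D.feasibleSw s x = ∅ ∧
    ∀ i, (D.localSet i (x i) ∩ D.switchSet i (s i)).Nonempty

/-- Controllable pieces with stabilizing gains, and an equilibrium at the origin. -/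
structure SystemAssumption : Prop where
  controllable : ∀ i l, IsControllablePair (S.A i l) (S.B i l)
  schur : ∀ i l, IsSchur (S.A i l + S.B i l * D.K i l)
  equilibrium : ∀ i l, 0 ∈ closure (S.P i l) → S.c i l = 0

/-- Terminal sets: closed neighbourhoods of the origin relative to the state constraint sets, inside
the regions touching the origin, invariant under the terminal controllers for all states of the
neighbours in their terminal sets; the terminal controllers also preserve the coupled constraints. -/
structure TerminalAssumption : Prop where
  isClosed : ∀ i, IsClosed (D.XT i)
  zero_mem : ∀ i, 0 ∈ D.XT i
  mem_nhdsWithin : ∀ i, D.XT i ∈ 𝓝[S.X i] 0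
  subset : ∀ i, D.XT i ⊆ ⋃ l ∈ {l | 0 ∈ closure (S.P i l)}, S.P i l
  input_mem : ∀ i, ∀ x ∈ D.XT i, ∀ l, x ∈ S.P i l → D.K i l *ᵥ x ∈ S.U i
  invariant : ∀ i, ∀ x ∈ D.XT i, ∀ l, x ∈ S.P i l →
    ∀ xn : ∀ j : S.nbr i, S.St j, (∀ j : S.nbr i, xn j ∈ D.XT j) →
      S.f i x (D.K i l *ᵥ x) xn ∈ D.XT i
  coupled : ∀ x ∈ D.XTglobal, (∀ i, S.h i (x i) (S.nbrState x i) ≤ 0) →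
    ∀ l : ∀ i, Fin (S.L i), (∀ i, x i ∈ S.P i (l i)) →
      ∀ i, S.h i (S.next x (fun i => D.K i (l i) *ᵥ x i) i)
        (S.nbrState (S.next x (fun i => D.K i (l i) *ᵥ x i)) i) ≤ 0

/-- Quadratic costs, and a terminal cost that is a common Lyapunov function on the terminal set. -/
structure CostAssumption : Prop where
  posDef_Q : ∀ i, (D.Q i).PosDef
  posDef_R : ∀ i, (D.R i).PosDef
  posDef_Φ : ∀ i, (D.Φ i).PosDef
  posSemidef_Qc : ∀ i j, (D.Qc i j).PosSemidef
  decrease : ∀ x ∈ D.XTglobal, ∀ l : ∀ i, Fin (S.L i), (∀ i, x i ∈ S.P i (l i)) →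
    ∑ i, (D.Vf i (S.f i (x i) (D.K i (l i) *ᵥ x i) (S.nbrState x i)) - D.Vf i (x i)
      + D.stage i (x i) (D.K i (l i) *ᵥ x i) (S.nbrState x i)) ≤ 0

/-! ### Conclusions -/

/-- The origin is exponentially stable for the closed loop, with region of attraction `X_0`:
uniform exponential decay from initial states near the origin, exponential convergence with the
same rate from every initial state in `X_0`, with a constant that is uniform on the whole of `X_0`
if the constraint sets are bounded. (The norm is the sup norm, equivalent to the Euclidean one.) -/
def ExponentiallyStabilizing : Prop :=
  ∃ γ : ℝ, 0 < γ ∧ γ < 1 ∧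
    (∃ δ > 0, ∃ C : ℝ, ∀ x0 u0 σ, D.IsInitial x0 u0 → D.IsClosedLoop x0 u0 σ → ‖x0‖ < δ →
      ∀ t, ‖(σ t).1‖ ≤ C * γ ^ t * ‖x0‖) ∧
    (∀ x0 u0 σ, D.IsInitial x0 u0 → D.IsClosedLoop x0 u0 σ →
      ∃ C : ℝ, ∀ t, ‖(σ t).1‖ ≤ C * γ ^ t * ‖x0‖) ∧
    ((∀ i, Bornology.IsBounded (S.X i)) → (∀ i, Bornology.IsBounded (S.U i)) →
      ∃ C : ℝ, ∀ x0 u0 σ, D.IsInitial x0 u0 → D.IsClosedLoop x0 u0 σ →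
        ∀ t, ‖(σ t).1‖ ≤ C * γ ^ t * ‖x0‖)

/-- The control law is well defined along the closed loop: from every loop state that is reached,
a next time step exists, and every execution of switching ADMM that the algorithm can start there
converges. -/
def WellPosed : Prop :=
  ∀ x0 u0, D.IsInitial x0 u0 → ∀ σ, Relation.ReflTransGen (D.Step u0) (x0, none) σ →
    (∃ σ', D.Step u0 σ σ') ∧
    (σ.1 ∉ D.XTglobal → ∀ u, D.IsGuess u0 σ.2 u → ∀ s y z lam, D.IsSwADMM σ.1 u s y z lam →
      ∃ y', Tendsto y atTop (𝓝 y'))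

end MPCDesign

end

/-! The summed cost of the plans is a Lyapunov function outside the terminal set, and the terminal
cost is one inside it; switching ADMM only has to deliver feasible plans that are no worse than the
shifted previous plan.

Feasibility of plans. Once the switching sequence is frozen, ADMM runs on a fixed convex problem. If
the iterates converge with limiting consensus residual r', the multipliers grow like `τ • (ρ • r')`,
whereas comparison with one consistent feasible point bounds their pairing with the residuals.
Dividing by τ leaves ρ‖r'‖² ≤ 0, so the limit is consistent (`IsSwADMM.limit_mem`). The coupling
assumption supplies the comparison point.

Decay. Shifting a feasible plan and appending the terminal controller gives a feasible roll-out that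
is cheaper by the current stage cost (`IsShiftedGuess.rollout_feasible`). The acceptance test keeps
the plan at most as expensive. Outside the terminal set the state norm is at least some δ > 0, so
each step costs at least a fixed η > 0. A first plan of cost at most J therefore forces entry into
the terminal set within about J / η steps. There the terminal cost contracts geometrically
(`exists_terminal_decay`). The finite transient affects only the constant, never the rate γ, and
that constant depends on the trajectory only through J.

Convergence of ADMM. With polyhedral data, Farkas' lemma yields multipliers for the consensus
constraint without a constraint qualification (`IsPolyhedral.exists_multiplier`, `exists_saddle`).
At the resulting saddle point the classical ADMM energy decreases (`admm_tendsto`). The cost is only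
semidefinite in the copies, so states and inputs converge through the cost, and copies through the
vanishing residual.

Existence of runs. Local minimizers exist by quadratic growth, and a switch leads only to sequences
that the current minimizer already satisfies, so the local problems never become infeasible
(`WeaklyFeasible.exists_isSwADMM`). -/

/-! ### Polyhedral optimization -/

section Polyhedral

variable {V W : Type*} [AddCommGroup V] [Module ℝ V] [AddCommGroup W] [Module ℝ W]

/-- **Farkas' lemma** for finitely many linear functionals on a real vector space. -/
theorem farkas {ι : Type*} (s : Finset ι) (a : ι → V →ₗ[ℝ] ℝ) (b : V →ₗ[ℝ] ℝ)
    (h : ∀ v, (∀ k ∈ s, a k v ≤ 0) → b v ≤ 0) :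
    ∃ μ : ι → ℝ, (∀ k, 0 ≤ μ k) ∧ b = ∑ k ∈ s, μ k • a k := by
  classical
  induction s using Finset.induction_on generalizing a b with
  | empty =>
    refine ⟨0, fun _ => le_rfl, ?_⟩
    ext v
    have h1 := h v (by simp)
    have h2 := h (-v) (by simp)
    simp only [map_neg] at h2
    simp only [Finset.sum_empty, LinearMap.zero_apply]
    linarith
  | insert q s hq ih =>
    -- If `a q` is redundant, it gets weight zero. Otherwise some `v₁` violates the implication
    -- without it, which forces `a q v₁ > 0`; `v₀` is `v₁` rescaled so that `a q v₀ = 1`.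
    by_cases hs : ∀ v, (∀ k ∈ s, a k v ≤ 0) → b v ≤ 0
    · obtain ⟨μ, hμ, hb⟩ := ih a b hs
      refine ⟨fun k => if k = q then 0 else μ k, fun k => ?_, ?_⟩
      · dsimp only
        split_ifs
        exacts [le_rfl, hμ k]
      · rw [Finset.sum_insert hq, hb]
        simp only [if_true, zero_smul, zero_add]
        refine Finset.sum_congr rfl fun k hk => ?_
        rw [if_neg (ne_of_mem_of_not_mem hk hq)]
    · push Not at hs
      obtain ⟨v₁, hv₁, hbv₁⟩ := hs
      have hq₁ : 0 < a q v₁ := by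
        by_contra hneg
        push Not at hneg
        have := h v₁ (by
          intro k hk
          rcases Finset.mem_insert.1 hk with rfl | hk
          exacts [hneg, hv₁ k hk])
        linarith
      obtain ⟨v₀, hv₀, hbv₀, hq₀⟩ :
          ∃ v₀, (∀ k ∈ s, a k v₀ ≤ 0) ∧ 0 < b v₀ ∧ a q v₀ = 1 := by
        refine ⟨(a q v₁)⁻¹ • v₁, fun k hk => ?_, ?_, ?_⟩
        · rw [map_smul, smul_eq_mul]
          exact mul_nonpos_of_nonneg_of_nonpos (inv_nonneg.2 hq₁.le) (hv₁ k hk)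
        · rw [map_smul, smul_eq_mul]
          positivity
        · rw [map_smul, smul_eq_mul, inv_mul_cancel₀ hq₁.ne']
      -- The new functionals are the old ones composed with the projection `v - a q v • v₀` onto the
      -- kernel of `a q`, where the constraint `q` holds with equality.
      obtain ⟨μ, hμ, hb⟩ := ih (fun k => a k - a k v₀ • a q) (b - b v₀ • a q) (by
        intro v hv
        have := h (v - a q v • v₀) (by
          intro k hk
          rcases Finset.mem_insert.1 hk with rfl | hk
          · simp [hq₀]
          · have := hv k hk
            simp only [LinearMap.sub_apply, LinearMap.smul_apply, smul_eq_mul] at this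
            simp only [map_sub, map_smul, smul_eq_mul]
            linarith)
        simp only [map_sub, map_smul, smul_eq_mul] at this
        simp only [LinearMap.sub_apply, LinearMap.smul_apply, smul_eq_mul]
        linarith)
      -- The weight of `q` is forced by evaluating the identity at `v₀`; it is nonnegative since `b
      -- v₀ > 0` and all `a k v₀ ≤ 0`.
      refine ⟨fun k => if k = q then b v₀ - ∑ k ∈ s, μ k * a k v₀ else μ k, fun k => ?_, ?_⟩
      · dsimp only
        split_ifs
        · have : ∑ k ∈ s, μ k * a k v₀ ≤ 0 :=
            Finset.sum_nonpos fun k hk => mul_nonpos_of_nonneg_of_nonpos (hμ k) (hv₀ k hk)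
          linarith
        · exact hμ k
      · rw [Finset.sum_insert hq]
        have h1 : ∑ k ∈ s, (if k = q then b v₀ - ∑ k ∈ s, μ k * a k v₀ else μ k) • a k
            = ∑ k ∈ s, μ k • a k := by
          refine Finset.sum_congr rfl fun k hk => ?_
          rw [if_neg (ne_of_mem_of_not_mem hk hq)]
        rw [h1]
        simp only [if_true]
        have h2 : b = b v₀ • a q + ∑ k ∈ s, μ k • (a k - a k v₀ • a q) := by
          rw [← hb]; abel
        rw [h2]
        ext v
        have hq0 : (b v₀ • a q + ∑ k ∈ s, μ k • (a k - a k v₀ • a q)) v₀ = b v₀ := by rw [← h2]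
        rw [hq0]
        simp only [LinearMap.add_apply, LinearMap.smul_apply, LinearMap.sum_apply,
          LinearMap.sub_apply, smul_eq_mul, mul_sub, sub_mul, Finset.sum_sub_distrib,
          Finset.sum_mul]
        have : ∀ k, μ k * (a k v₀ * a q v) = μ k * a k v₀ * a q v := fun k => by ring
        simp only [this]
        ring

/-- A polyhedral subset of a real vector space: finitely many affine inequalities. -/
def IsPolyhedral (C : Set V) : Prop :=
  ∃ s : Finset (V →ᵃ[ℝ] ℝ), C = {y | ∀ k ∈ s, k y ≤ 0}

theorem IsPolyhedral.inter {C C' : Set V} (h : IsPolyhedral C) (h' : IsPolyhedral C') :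
    IsPolyhedral (C ∩ C') := by
  classical
  obtain ⟨s, rfl⟩ := h
  obtain ⟨s', rfl⟩ := h'
  refine ⟨s ∪ s', ?_⟩
  ext y
  simp only [Set.mem_inter_iff, Set.mem_ofPred_eq, Finset.mem_union]
  grind

theorem IsPolyhedral.iInter {ι : Type*} [Finite ι] {C : ι → Set V} (h : ∀ i, IsPolyhedral (C i)) :
    IsPolyhedral {y | ∀ i, y ∈ C i} := by
  classical
  cases nonempty_fintype ι
  choose s hs using h
  refine ⟨Finset.univ.biUnion s, ?_⟩
  ext y
  simp only [hs, Set.mem_ofPred_eq, Finset.mem_biUnion, Finset.mem_univ, true_and]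
  grind

theorem IsPolyhedral.preimage {C : Set W} (h : IsPolyhedral C) (g : V →ᵃ[ℝ] W) :
    IsPolyhedral {y | g y ∈ C} := by
  classical
  obtain ⟨s, rfl⟩ := h
  refine ⟨s.image fun k => k.comp g, ?_⟩
  ext y
  simp

theorem isPolyhedral_nonpos (k : V →ᵃ[ℝ] ℝ) : IsPolyhedral {y | k y ≤ 0} :=
  ⟨{k}, by simp⟩

theorem isPolyhedral_pi_nonpos {ι : Type*} [Finite ι] : IsPolyhedral {w : ι → ℝ | w ≤ 0} :=
  IsPolyhedral.iInter (C := fun i => {w : ι → ℝ | w i ≤ 0}) fun i =>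
    isPolyhedral_nonpos (LinearMap.proj i : (ι → ℝ) →ₗ[ℝ] ℝ).toAffineMap

theorem isPolyhedral_pi_zero {ι : Type*} [Finite ι] : IsPolyhedral {w : ι → ℝ | w = 0} := by
  have h := (isPolyhedral_pi_nonpos (ι := ι)).inter
    ((isPolyhedral_pi_nonpos (ι := ι)).preimage (-LinearMap.id : (ι → ℝ) →ₗ[ℝ] _).toAffineMap)
  convert h using 1
  ext w
  simp only [Set.mem_ofPred_eq, Set.mem_inter_iff, LinearMap.coe_toAffineMap, LinearMap.neg_apply,
    LinearMap.id_apply, Left.neg_nonpos_iff]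
  exact le_antisymm_iff

theorem IsPolyhedron.isPolyhedral {n : ℕ} {T : Set (Fin n → ℝ)} (h : IsPolyhedron T) :
    IsPolyhedral T := by
  obtain ⟨q, G, g, rfl⟩ := h
  have := (isPolyhedral_pi_nonpos (ι := Fin q)).preimage
    ((Matrix.mulVecLin G).toAffineMap - AffineMap.const ℝ (Fin n → ℝ) g)
  convert this using 1
  ext x
  simp

theorem IsPolyhedral.convex {C : Set V} (h : IsPolyhedral C) : Convex ℝ C := by
  obtain ⟨s, rfl⟩ := h
  have : {y : V | ∀ k ∈ s, k y ≤ 0} = ⋂ k ∈ s, k ⁻¹' Set.Iic 0 := by ext; simp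
  rw [this]
  exact convex_iInter₂ fun k _ => (convex_Iic (0 : ℝ)).affine_preimage k

/-- Lagrange multipliers for the subspace constraint of a polyhedral problem. -/
theorem IsPolyhedral.exists_multiplier {C : Set V} (hC : IsPolyhedral C) (L : Submodule ℝ V)
    (b : V →ₗ[ℝ] ℝ) {y₀ : V} (hy₀ : y₀ ∈ C)
    (hmin : ∀ y ∈ C, y - y₀ ∈ L → 0 ≤ b (y - y₀)) :
    ∃ ν : V →ₗ[ℝ] ℝ, (∀ v ∈ L, ν v = 0) ∧ ∀ y ∈ C, 0 ≤ b (y - y₀) + ν (y - y₀) := by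
  classical
  obtain ⟨s, rfl⟩ := hC
  have hlin : ∀ (k : V →ᵃ[ℝ] ℝ) (v : V), k (y₀ + v) = k y₀ + k.linear v := by
    intro k v
    have := k.map_vadd y₀ v
    simp only [vadd_eq_add] at this
    rw [add_comm, this, add_comm]
  -- Only constraints active at `y₀` enter, restricted to `L`. A direction in `L` along which none
  -- of them increases is feasible for small steps, so `b` is nonnegative on it.
  obtain ⟨μ, hμ, hb⟩ := farkas (s.filter fun k => k y₀ = 0) (fun k => k.linear.comp L.subtype)
    (-(b.comp L.subtype)) (by
      rintro ⟨v, hv⟩ hk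
      simp only [Finset.mem_filter, and_imp, LinearMap.comp_apply, Submodule.subtype_apply] at hk
      simp only [LinearMap.neg_apply, LinearMap.comp_apply, Submodule.subtype_apply,
        Left.neg_nonpos_iff]
      have hev : ∀ᶠ t in 𝓝[>] (0 : ℝ), ∀ k ∈ s, k (y₀ + t • v) ≤ 0 := by
        rw [Filter.eventually_all_finset]
        intro k hks
        simp only [hlin, map_smul, smul_eq_mul]
        rcases (hy₀ k hks).lt_or_eq with hlt | heq
        · have hc : Tendsto (fun t : ℝ => k y₀ + t * k.linear v) (𝓝[>] 0)
              (𝓝 (k y₀ + 0 * k.linear v)) :=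
            ((by fun_prop : Continuous fun t : ℝ => k y₀ + t * k.linear v).tendsto 0).mono_left
              nhdsWithin_le_nhds
          rw [zero_mul, add_zero] at hc
          exact (hc.eventually_lt_const hlt).mono fun _ h => h.le
        · filter_upwards [self_mem_nhdsWithin] with t ht
          rw [heq, zero_add]
          exact mul_nonpos_of_nonneg_of_nonpos (le_of_lt ht) (hk k hks heq)
      obtain ⟨t, ht, ht0⟩ := (hev.and self_mem_nhdsWithin).exists
      have := hmin (y₀ + t • v) ht (by simpa using L.smul_mem t hv)
      rw [add_sub_cancel_left, map_smul, smul_eq_mul] at this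
      exact nonneg_of_mul_nonneg_right this ht0)
  -- With this choice `b + ν` is minus the nonnegative combination of the active gradients. These
  -- are nonpositive on `y - y₀`, as the active constraints vanish at `y₀` and are nonpositive at
  -- `y`.
  refine ⟨-b - ∑ k ∈ s.filter fun k => k y₀ = 0, μ k • k.linear, fun v hv => ?_, fun y hy => ?_⟩
  · have := LinearMap.congr_fun hb ⟨v, hv⟩
    simp only [LinearMap.neg_apply, LinearMap.comp_apply, Submodule.subtype_apply,
      LinearMap.sum_apply, LinearMap.smul_apply] at this
    simp only [LinearMap.sub_apply, LinearMap.neg_apply, LinearMap.sum_apply,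
      LinearMap.smul_apply, this, sub_self]
  · have : ∑ k ∈ s.filter (fun k => k y₀ = 0), μ k • k.linear (y - y₀) ≤ 0 := by
      refine Finset.sum_nonpos fun k hk => ?_
      obtain ⟨hks, hk0⟩ := Finset.mem_filter.1 hk
      have h1 := hlin k (y - y₀)
      rw [add_sub_cancel, hk0, zero_add] at h1
      rw [← h1, smul_eq_mul]
      exact mul_nonpos_of_nonneg_of_nonpos (hμ k) (hy k hks)
    simp only [LinearMap.sub_apply, LinearMap.neg_apply, LinearMap.sum_apply,
      LinearMap.smul_apply]
    linarith

end Polyhedral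

/-! ### Convergence of the alternating direction method of multipliers -/

section ADMM

variable {V H : Type*} [AddCommGroup V] [Module ℝ V] [AddCommGroup H] [Module ℝ H]

/-- If `t * p + t ^ 2 * q` is nonnegative for `t ∈ (0, 1]`, then `p` is nonnegative. -/
theorem nonneg_of_forall_linear_add_sq {p q : ℝ}
    (h : ∀ t : ℝ, 0 < t → t ≤ 1 → 0 ≤ t * p + t ^ 2 * q) : 0 ≤ p := by
  have hc : Tendsto (fun t : ℝ => p + t * q) (𝓝[>] 0) (𝓝 (p + 0 * q)) :=
    ((by fun_prop : Continuous fun t : ℝ => p + t * q).tendsto 0).mono_left nhdsWithin_le_nhds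
  rw [zero_mul, add_zero] at hc
  refine ge_of_tendsto hc ?_
  filter_upwards [Ioc_mem_nhdsGT (zero_lt_one' ℝ)] with t ht
  have := h t ht.1 ht.2
  have h2 : t * p + t ^ 2 * q = t * (p + t * q) := by ring
  rw [h2] at this
  exact nonneg_of_mul_nonneg_right this ht.1

/-- First-order optimality condition for a quadratic objective over a convex set. -/
theorem IsMinOn.variational_inequality {B : LinearMap.BilinForm ℝ V} (hB : ∀ v w, B v w = B w v)
    {G : LinearMap.BilinForm ℝ H} (hG : ∀ v w, G v w = G w v) {T : V →ₗ[ℝ] H} {C : Set V}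
    (hC : Convex ℝ C) {ρ : ℝ} {lam z : H} {y₀ : V} (hy₀ : y₀ ∈ C)
    (hmin : IsMinOn (fun y => B y y + G lam (T y) + ρ / 2 * G (T y - z) (T y - z)) C y₀)
    {y : V} (hy : y ∈ C) :
    0 ≤ 2 * B y₀ (y - y₀) + G (lam + ρ • (T y₀ - z)) (T (y - y₀)) := by
  -- Along the segment from `y₀` to `y` the objective changes by `t` times the claimed quantity plus
  -- `t ^ 2` times this `q`.
  refine nonneg_of_forall_linear_add_sq
    (q := B (y - y₀) (y - y₀) + ρ / 2 * G (T (y - y₀)) (T (y - y₀))) fun t ht0 ht1 => ?_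
  have h := hmin (hC.add_smul_sub_mem hy₀ hy ⟨ht0.le, ht1⟩)
  simp only [Set.mem_ofPred_eq] at h
  have e : T (y₀ + t • (y - y₀)) - z = (T y₀ - z) + t • T (y - y₀) := by
    rw [map_add, map_smul]; abel
  rw [e] at h
  generalize T y₀ - z = r at h ⊢
  generalize y - y₀ = d at h ⊢
  simp only [map_add, map_smul, LinearMap.add_apply, LinearMap.smul_apply, smul_eq_mul] at h ⊢
  rw [hB d y₀, hG (T d) r] at h
  linarith

/-- In the alternating direction method of multipliers for a convex quadratic problem with a saddle
point, the primal error tends to zero in the seminorm of the objective, and the consensus residual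
tends to zero. -/
theorem admm_tendsto {B : LinearMap.BilinForm ℝ V} (hB : ∀ v w, B v w = B w v)
    (hB0 : ∀ v, 0 ≤ B v v) {G : LinearMap.BilinForm ℝ H} (hG : ∀ v w, G v w = G w v)
    (hG0 : ∀ v, 0 ≤ G v v) {T : V →ₗ[ℝ] H} {C : Set V} (hC : Convex ℝ C) {L : Submodule ℝ H}
    {ρ : ℝ} (hρ : 0 < ρ) {y₀ : V} {lam₀ : H} (hy₀ : y₀ ∈ C) (hTy₀ : T y₀ ∈ L)
    (hlam₀ : ∀ w ∈ L, G lam₀ w = 0)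
    (hsaddle : ∀ y ∈ C, 0 ≤ 2 * B y₀ (y - y₀) + G lam₀ (T (y - y₀)))
    {y : ℕ → V} {z lam : ℕ → H} (hy : ∀ τ, y τ ∈ C)
    (hmin : ∀ τ, IsMinOn
      (fun y => B y y + G (lam τ) (T y) + ρ / 2 * G (T y - z τ) (T y - z τ)) C (y τ))
    (hz : ∀ τ, z τ ∈ L) (hlam : ∀ τ, ∀ w ∈ L, G (lam τ) w = 0)
    (hstep : ∀ τ, lam (τ + 1) = lam τ + ρ • (T (y τ) - z (τ + 1))) :
    Tendsto (fun τ => B (y τ - y₀) (y τ - y₀)) atTop (𝓝 0) ∧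
      Tendsto (fun τ => G (T (y τ) - z (τ + 1)) (T (y τ) - z (τ + 1))) atTop (𝓝 0) := by
  -- The classical ADMM energy: squared distances of multiplier and consensus variable from the
  -- saddle point, weighted by 1/ρ and ρ.
  set E : ℕ → ℝ := fun τ => ρ⁻¹ * G (lam τ - lam₀) (lam τ - lam₀)
    + ρ * G (z τ - T y₀) (z τ - T y₀) with hE
  have hE0 : ∀ τ, 0 ≤ E τ := fun τ => by
    have := hG0 (lam τ - lam₀)
    have := hG0 (z τ - T y₀)
    positivity
  have hres : ∀ τ, ∀ w ∈ L, G (T (y τ) - z (τ + 1)) w = 0 := fun τ w hw => by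
    have h1 := hlam (τ + 1) w hw
    rw [hstep, map_add, LinearMap.add_apply, hlam τ w hw, map_smul, LinearMap.smul_apply,
      smul_eq_mul, zero_add] at h1
    exact (mul_eq_zero.1 h1).resolve_left hρ.ne'
  -- Add the optimality condition of `y τ`, tested at `y₀`, to the saddle inequality, tested at `y
  -- τ`. Residuals and multiplier errors are orthogonal to `L`, which removes the cross terms; what
  -- remains is the energy drop, up to a nonnegative multiple of `‖z (τ + 1) - z τ‖²`.
  have hdec : ∀ τ, 4 * B (y τ - y₀) (y τ - y₀)
      + ρ * G (T (y τ) - z (τ + 1)) (T (y τ) - z (τ + 1)) ≤ E τ - E (τ + 1) := by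
    intro τ
    have h1 := (hmin τ).variational_inequality hB hG hC (hy τ) hy₀
    have h2 := hsaddle (y τ) (hy τ)
    have e1 : lam τ + ρ • (T (y τ) - z τ)
        = lam₀ + ((lam τ - lam₀) + ρ • (T (y τ) - z (τ + 1)) + ρ • (z (τ + 1) - z τ)) := by
      module
    have e2 : T (y₀ - y τ) = -((T (y τ) - z (τ + 1)) + (z (τ + 1) - T y₀)) := by
      rw [map_sub]; abel
    have e3 : lam (τ + 1) - lam₀ = (lam τ - lam₀) + ρ • (T (y τ) - z (τ + 1)) := by
      rw [hstep]; abel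
    have e4 : B (y τ) (y₀ - y τ) = -(B y₀ (y τ - y₀) + B (y τ - y₀) (y τ - y₀)) := by
      simp only [map_sub, LinearMap.sub_apply]
      ring
    have e5 : T (y τ - y₀) = -T (y₀ - y τ) := by rw [← map_neg, neg_sub]
    have o1 := hres τ _ (L.sub_mem (hz (τ + 1)) hTy₀)
    have o2 := hres τ _ (L.sub_mem (hz (τ + 1)) (hz τ))
    have o3 : G (lam τ - lam₀) (z (τ + 1) - T y₀) = 0 := by
      have := L.sub_mem (hz (τ + 1)) hTy₀
      rw [map_sub G, LinearMap.sub_apply, hlam τ _ this, hlam₀ _ this, sub_zero]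
    rw [e4, e1, map_add G lam₀, LinearMap.add_apply] at h1
    rw [e5, map_neg] at h2
    rw [e2] at h1 h2
    have h3 := add_le_add h1 h2
    simp only [hE, e3]
    have e6 : z τ - T y₀ = (z (τ + 1) - T y₀) - (z (τ + 1) - z τ) := by abel
    rw [e6]
    have hn := hG0 (z (τ + 1) - z τ)
    generalize T (y τ) - z (τ + 1) = r at *
    generalize z (τ + 1) - T y₀ = p at *
    generalize z (τ + 1) - z τ = d at *
    generalize lam τ - lam₀ = m at *
    simp only [map_add, map_neg, map_sub, map_smul, LinearMap.add_apply, LinearMap.smul_apply,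
      LinearMap.sub_apply, smul_eq_mul] at h3 ⊢
    rw [hG d r, o1, o2, o3] at h3
    rw [hG r m, hG p d]
    have hi : ρ⁻¹ * ρ = 1 := inv_mul_cancel₀ hρ.ne'
    have e7 : ρ⁻¹ * (G m m + ρ * G m r + ρ * (G m r + ρ * G r r))
        = ρ⁻¹ * G m m + ρ⁻¹ * ρ * (2 * G m r + ρ * G r r) := by ring
    rw [e7, hi]
    nlinarith [mul_nonneg hρ.le hn]
  have hanti : Antitone E := antitone_nat_of_succ_le fun τ => by
    have := hdec τ
    have := hB0 (y τ - y₀)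
    have := mul_nonneg hρ.le (hG0 (T (y τ) - z (τ + 1)))
    linarith
  have hlim := tendsto_atTop_ciInf hanti ⟨0, by rintro _ ⟨τ, rfl⟩; exact hE0 τ⟩
  have hdiff : Tendsto (fun τ => E τ - E (τ + 1)) atTop (𝓝 0) := by
    simpa using hlim.sub (hlim.comp (tendsto_add_atTop_nat 1))
  constructor
  · refine squeeze_zero (fun τ => hB0 _) (fun τ => ?_) hdiff
    have := hdec τ
    have := hB0 (y τ - y₀)
    have := mul_nonneg hρ.le (hG0 (T (y τ) - z (τ + 1)))
    linarith
  · have hdiff' : Tendsto (fun τ => ρ⁻¹ * (E τ - E (τ + 1))) atTop (𝓝 0) := by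
      simpa using hdiff.const_mul ρ⁻¹
    refine squeeze_zero (fun τ => hG0 _) (fun τ => ?_) hdiff'
    have := hdec τ
    have := hB0 (y τ - y₀)
    rw [le_inv_mul_iff₀ hρ]
    linarith

end ADMM

/-! ### Coercive functions -/

section Coercive

variable {E : Type*} [NormedAddCommGroup E] [NormedSpace ℝ E] [FiniteDimensional ℝ E]

/-- A continuous positive definite function that is homogeneous of degree two is bounded below by a
multiple of the squared norm. -/
theorem exists_mul_sq_norm_le {q : E → ℝ} (hq : Continuous q)
    (hhom : ∀ (t : ℝ) v, q (t • v) = t ^ 2 * q v) (hpos : ∀ v, v ≠ 0 → 0 < q v) :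
    ∃ a > 0, ∀ v, a * ‖v‖ ^ 2 ≤ q v := by
  have h0 : q 0 = 0 := by simpa using hhom 0 0
  have := FiniteDimensional.proper ℝ E
  -- The unit sphere is empty exactly when the space is trivial.
  rcases (Metric.sphere (0 : E) 1).eq_empty_or_nonempty with hS | hS
  · refine ⟨1, one_pos, fun v => ?_⟩
    have : v = 0 := by
      by_contra hv
      have : ‖v‖⁻¹ • v ∈ Metric.sphere (0 : E) 1 := by
        simp [norm_smul, inv_mul_cancel₀ (norm_ne_zero_iff.2 hv)]
      simp [hS] at this
    simp [this, h0]
  · obtain ⟨e, he, hmin⟩ := (isCompact_sphere (0 : E) 1).exists_isMinOn hS hq.continuousOn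
    refine ⟨q e, hpos e (by rintro rfl; simp at he), fun v => ?_⟩
    by_cases hv : v = 0
    · simp [hv, h0]
    have hn := norm_ne_zero_iff.2 hv
    have h1 := hmin (show ‖v‖⁻¹ • v ∈ Metric.sphere (0 : E) 1 by
      simp [norm_smul, inv_mul_cancel₀ hn])
    have h2 := hhom ‖v‖ (‖v‖⁻¹ • v)
    rw [smul_inv_smul₀ hn] at h2
    rw [h2, mul_comm]
    exact mul_le_mul_of_nonneg_left h1 (sq_nonneg _)

/-- A continuous function that is homogeneous of degree two is bounded above by a multiple of the
squared norm. -/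
theorem exists_le_mul_sq_norm {q : E → ℝ} (hq : Continuous q)
    (hhom : ∀ (t : ℝ) v, q (t • v) = t ^ 2 * q v) :
    ∃ b > 0, ∀ v, q v ≤ b * ‖v‖ ^ 2 := by
  have h0 : q 0 = 0 := by simpa using hhom 0 0
  have := FiniteDimensional.proper ℝ E
  obtain ⟨b, hb⟩ := (isCompact_sphere (0 : E) 1).bddAbove_image hq.continuousOn
  refine ⟨max b 1, by positivity, fun v => ?_⟩
  by_cases hv : v = 0
  · simp [hv, h0]
  have hn := norm_ne_zero_iff.2 hv
  have h1 : q (‖v‖⁻¹ • v) ≤ b := hb ⟨_, by simp [norm_smul, inv_mul_cancel₀ hn], rfl⟩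
  have h2 := hhom ‖v‖ (‖v‖⁻¹ • v)
  rw [smul_inv_smul₀ hn] at h2
  rw [h2, mul_comm]
  exact mul_le_mul_of_nonneg_right (h1.trans (le_max_left _ _)) (sq_nonneg _)

/-- A continuous function with quadratic growth on a closed set attains its minimum there. -/
theorem exists_isMinOn_of_quadratic_growth {C : Set E} (hC : IsClosed C) (hne : C.Nonempty)
    {g : E → ℝ} (hg : Continuous g) {a c : ℝ} (ha : 0 < a) (w : E)
    (h : ∀ y ∈ C, a * ‖y - w‖ ^ 2 + c ≤ g y) : ∃ y ∈ C, IsMinOn g C y := by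
  have := FiniteDimensional.proper ℝ E
  obtain ⟨y₁, hy₁⟩ := hne
  refine hg.continuousOn.exists_isMinOn' hC hy₁ ?_
  have hev : ∀ᶠ y in cocompact E, g y₁ ≤ a * ‖y - w‖ ^ 2 + c := by
    have h1 : Tendsto (fun y : E => ‖y - w‖) (cocompact E) atTop := by
      simpa only [dist_eq_norm] using tendsto_dist_right_cocompact_atTop w
    have h2 : Tendsto (fun y : E => a * ‖y - w‖ ^ 2 + c) (cocompact E) atTop :=
      tendsto_atTop_add_const_right _ _
        (((tendsto_pow_atTop two_ne_zero).comp h1).const_mul_atTop ha)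
    exact h2.eventually_ge_atTop _
  rw [eventually_inf_principal]
  exact hev.mono fun y hy hyC => hy.trans (h y hyC)

end Coercive

/-! ### Quadratic forms of positive definite matrices -/

theorem Matrix.PosDef.dotProduct_pos {n : ℕ} {Q : Matrix (Fin n) (Fin n) ℝ} (hQ : Q.PosDef)
    {x : Fin n → ℝ} (hx : x ≠ 0) : 0 < x ⬝ᵥ Q *ᵥ x := by
  simpa using hQ.dotProduct_mulVec_pos hx

theorem Matrix.PosSemidef.dotProduct_nonneg {n : ℕ} {Q : Matrix (Fin n) (Fin n) ℝ}
    (hQ : Q.PosSemidef) (x : Fin n → ℝ) : 0 ≤ x ⬝ᵥ Q *ᵥ x := by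
  simpa using hQ.dotProduct_mulVec_nonneg x

theorem Matrix.IsHermitian.dotProduct_comm {n : ℕ} {Q : Matrix (Fin n) (Fin n) ℝ}
    (hQ : Q.IsHermitian) (x y : Fin n → ℝ) : x ⬝ᵥ Q *ᵥ y = y ⬝ᵥ Q *ᵥ x := by
  have h : Qᵀ = Q := by simpa [Matrix.IsHermitian, conjTranspose_eq_transpose_of_trivial] using hQ
  rw [Matrix.dotProduct_mulVec, ← mulVec_transpose, h, _root_.dotProduct_comm]

theorem dotProduct_self_nonneg_real {n : ℕ} (x : Fin n → ℝ) : 0 ≤ x ⬝ᵥ x :=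
  Finset.sum_nonneg fun _ _ => mul_self_nonneg _

noncomputable section

namespace MPCDesign

variable {M : ℕ} {S : PWANetwork M} (D : MPCDesign S)

/-! ### Costs as quadratic forms -/

/-- The predicted state of subsystem `i` at stage `k` as a linear function. -/
def ownMap (i : Fin M) (k : Fin (D.N + 1)) : D.LocVar i →ₗ[ℝ] S.St i :=
  LinearMap.proj k ∘ₗ LinearMap.fst ℝ _ _ ∘ₗ LinearMap.fst ℝ _ _

/-- The copy of the state of the neighbour `j` at stage `k` as a linear function. -/
def copyMap (i : Fin M) (j : S.nbr i) (k : Fin (D.N + 1)) : D.LocVar i →ₗ[ℝ] S.St j :=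
  LinearMap.proj k ∘ₗ LinearMap.proj j ∘ₗ LinearMap.snd ℝ _ _ ∘ₗ LinearMap.fst ℝ _ _

/-- The input of subsystem `i` at stage `k` as a linear function. -/
def inpMap (i : Fin M) (k : Fin D.N) : D.LocVar i →ₗ[ℝ] S.Inp i :=
  LinearMap.proj k ∘ₗ LinearMap.snd ℝ _ _

@[simp] theorem ownMap_apply (i : Fin M) (k) (y : D.LocVar i) :
    D.ownMap i k y = LocVar.own y k := rfl

@[simp] theorem copyMap_apply (i : Fin M) (j k) (y : D.LocVar i) :
    D.copyMap i j k y = LocVar.copy y j k := rfl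

@[simp] theorem inpMap_apply (i : Fin M) (k) (y : D.LocVar i) :
    D.inpMap i k y = LocVar.inp y k := rfl

/-- The bilinear form of the local cost. -/
def costForm (i : Fin M) : LinearMap.BilinForm ℝ (D.LocVar i) :=
  ∑ k : Fin D.N,
    ((Matrix.toBilin' (D.Q i)).comp (D.ownMap i k.castSucc) (D.ownMap i k.castSucc)
      + (Matrix.toBilin' (D.R i)).comp (D.inpMap i k) (D.inpMap i k)
      + ∑ j, (Matrix.toBilin' (D.Qc i j)).comp (D.copyMap i j k.castSucc)
          (D.copyMap i j k.castSucc))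
    + (Matrix.toBilin' (D.Φ i)).comp (D.ownMap i (Fin.last _)) (D.ownMap i (Fin.last _))

theorem costForm_apply (i : Fin M) (y y' : D.LocVar i) : D.costForm i y y' =
    ∑ k : Fin D.N,
      (LocVar.own y k.castSucc ⬝ᵥ D.Q i *ᵥ LocVar.own y' k.castSucc
        + LocVar.inp y k ⬝ᵥ D.R i *ᵥ LocVar.inp y' k
        + ∑ j, LocVar.copy y j k.castSucc ⬝ᵥ D.Qc i j *ᵥ LocVar.copy y' j k.castSucc)
      + LocVar.own y (Fin.last _) ⬝ᵥ D.Φ i *ᵥ LocVar.own y' (Fin.last _) := by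
  simp [costForm, LinearMap.sum_apply, Matrix.toBilin'_apply']

theorem costForm_self (i : Fin M) (y : D.LocVar i) : D.costForm i y y = D.cost i y :=
  D.costForm_apply i y y

/-- The bilinear form of the global cost. -/
def totalForm : LinearMap.BilinForm ℝ D.Var :=
  ∑ i, (D.costForm i).comp (LinearMap.proj i) (LinearMap.proj i)

theorem totalForm_apply (y y' : D.Var) : D.totalForm y y' = ∑ i, D.costForm i (y i) (y' i) := by
  simp [totalForm, LinearMap.sum_apply]

theorem totalForm_self (y : D.Var) : D.totalForm y y = ∑ i, D.cost i (y i) := by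
  simp [totalForm_apply, costForm_self]

/-- The Euclidean inner product of tuples of augmented trajectories. -/
def augForm : LinearMap.BilinForm ℝ (∀ i, D.Aug i) :=
  ∑ i, (∑ k, (Matrix.toBilin' 1).comp
      (LinearMap.proj k ∘ₗ LinearMap.fst ℝ _ _ ∘ₗ LinearMap.proj i)
      (LinearMap.proj k ∘ₗ LinearMap.fst ℝ _ _ ∘ₗ LinearMap.proj i)
    + ∑ j, ∑ k, (Matrix.toBilin' 1).comp
      (LinearMap.proj k ∘ₗ LinearMap.proj j ∘ₗ LinearMap.snd ℝ _ _ ∘ₗ LinearMap.proj i)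
      (LinearMap.proj k ∘ₗ LinearMap.proj j ∘ₗ LinearMap.snd ℝ _ _ ∘ₗ LinearMap.proj i))

theorem augForm_apply (a b : ∀ i, D.Aug i) : D.augForm a b = ∑ i, D.augDot (a i) (b i) := by
  simp [augForm, augDot, LinearMap.sum_apply, Matrix.toBilin'_apply']

theorem augDot_comm {i : Fin M} (a b : D.Aug i) : D.augDot a b = D.augDot b a := by
  simp only [augDot, dotProduct_comm]

theorem augDot_self_nonneg {i : Fin M} (a : D.Aug i) : 0 ≤ D.augDot a a :=
  add_nonneg (Finset.sum_nonneg fun _ _ => dotProduct_self_nonneg_real _)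
    (Finset.sum_nonneg fun _ _ => Finset.sum_nonneg fun _ _ => dotProduct_self_nonneg_real _)

theorem eq_zero_of_augDot_self {i : Fin M} {a : D.Aug i} (h : D.augDot a a ≤ 0) : a = 0 := by
  have h1 : 0 ≤ ∑ k, a.1 k ⬝ᵥ a.1 k := Finset.sum_nonneg fun _ _ => dotProduct_self_nonneg_real _
  have h2 : 0 ≤ ∑ j, ∑ k, a.2 j k ⬝ᵥ a.2 j k :=
    Finset.sum_nonneg fun _ _ => Finset.sum_nonneg fun _ _ => dotProduct_self_nonneg_real _
  unfold augDot at h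
  have h3 : ∑ k, a.1 k ⬝ᵥ a.1 k = 0 := by linarith
  have h4 : ∑ j, ∑ k, a.2 j k ⬝ᵥ a.2 j k = 0 := by linarith
  rw [Finset.sum_eq_zero_iff_of_nonneg fun _ _ => dotProduct_self_nonneg_real _] at h3
  rw [Finset.sum_eq_zero_iff_of_nonneg fun _ _ => Finset.sum_nonneg fun _ _ =>
    dotProduct_self_nonneg_real _] at h4
  refine Prod.ext (funext fun k => ?_) (funext fun j => funext fun k => ?_)
  · exact dotProduct_self_eq_zero.1 (h3 k (Finset.mem_univ _))
  · have h5 := h4 j (Finset.mem_univ _)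
    rw [Finset.sum_eq_zero_iff_of_nonneg fun _ _ => dotProduct_self_nonneg_real _] at h5
    exact dotProduct_self_eq_zero.1 (h5 k (Finset.mem_univ _))

theorem augForm_comm (a b : ∀ i, D.Aug i) : D.augForm a b = D.augForm b a := by
  simp only [augForm_apply, D.augDot_comm]

theorem augForm_self_nonneg (a : ∀ i, D.Aug i) : 0 ≤ D.augForm a a := by
  rw [augForm_apply]
  exact Finset.sum_nonneg fun _ _ => D.augDot_self_nonneg _

theorem eq_zero_of_augForm_self {a : ∀ i, D.Aug i} (h : D.augForm a a ≤ 0) : a = 0 := by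
  have h0 := le_antisymm h (D.augForm_self_nonneg a)
  rw [augForm_apply, Finset.sum_eq_zero_iff_of_nonneg fun _ _ => D.augDot_self_nonneg _] at h0
  exact funext fun i => D.eq_zero_of_augDot_self (h0 i (Finset.mem_univ _)).le

/-- The augmented trajectories in a global decision variable. -/
def augMap : D.Var →ₗ[ℝ] ∀ i, D.Aug i :=
  LinearMap.pi fun i => LinearMap.fst ℝ _ _ ∘ₗ LinearMap.proj i

@[simp] theorem augMap_apply (y : D.Var) (i : Fin M) : D.augMap y i = (y i).1 := rfl

/-- Distribution of a consensus variable to the subsystems. -/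
def augOfMap : (∀ i, D.Traj i) →ₗ[ℝ] ∀ i, D.Aug i where
  toFun z i := D.augOf z i
  map_add' _ _ := rfl
  map_smul' _ _ := rfl

@[simp] theorem augOfMap_apply (z : ∀ i, D.Traj i) (i : Fin M) :
    D.augOfMap z i = D.augOf z i := rfl

/-- The subspace of augmented trajectories that are in consensus. -/
def consensus : Submodule ℝ (∀ i, D.Aug i) := LinearMap.range D.augOfMap

theorem augOfMap_mem (z : ∀ i, D.Traj i) : D.augOfMap z ∈ D.consensus := ⟨z, rfl⟩

theorem augMap_mem_consensus_iff (y : D.Var) : D.augMap y ∈ D.consensus ↔ D.Consistent y := by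
  constructor
  · rintro ⟨z, hz⟩ i j
    have hi := congrFun hz i
    have hj := congrFun hz j
    have e1 : z j = (y i).1.2 j := congrFun (congrArg Prod.snd hi) j
    have e2 : z j = (y j).1.1 := congrArg Prod.fst hj
    exact e1.symm.trans e2
  · intro h
    refine ⟨fun i => LocVar.own (y i), funext fun i => Prod.ext rfl (funext fun j => ?_)⟩
    exact (h i j).symm

/-- The averaging step is the orthogonal projection onto consensus. -/
theorem augForm_sub_average (y : D.Var) (w : ∀ i, D.Traj i) :
    D.augForm (D.augMap y - D.augOfMap (D.average y)) (D.augOfMap w) = 0 := by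
  -- Double counting of the pairs (holder of a copy, copied subsystem): copies are regrouped by the
  -- subsystem that they describe.
  have key : ∀ b : ∀ i, ∀ _ : S.nbr i, ℝ,
      ∑ i, ∑ j : S.nbr i, b i j = ∑ i, ∑ j : {j // i ∈ S.nbr j}, b j ⟨i, j.2⟩ := by
    intro b
    rw [Finset.sum_sigma', Finset.sum_sigma']
    exact Fintype.sum_equiv
      { toFun := fun p : Σ i, S.nbr i => (⟨p.2.1, ⟨p.1, p.2.2⟩⟩ : Σ i, {j // i ∈ S.nbr j})
        invFun := fun p => ⟨p.2.1, ⟨p.1, p.2.2⟩⟩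
        left_inv := fun _ => rfl
        right_inv := fun _ => rfl } _ _ fun _ => rfl
  rw [augForm_apply]
  simp only [augDot, augOfMap_apply, augOf, Pi.sub_apply, augMap_apply, Prod.fst_sub,
    Prod.snd_sub, Finset.sum_add_distrib]
  rw [key fun i j => ∑ k, ((y i).1.2 j k - D.average y j k) ⬝ᵥ w j k, ← Finset.sum_add_distrib]
  refine Finset.sum_eq_zero fun i _ => ?_
  rw [Finset.sum_comm, ← Finset.sum_add_distrib]
  refine Finset.sum_eq_zero fun k _ => ?_
  refine (congrArg _ (sum_dotProduct Finset.univ (fun j : {j // i ∈ S.nbr j} =>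
    ((y j).1.2 ⟨i, j.2⟩ k - D.average y i k : S.St i)) (w i k)).symm).trans ?_
  rw [← add_dotProduct]
  -- Deviations of a trajectory and all its copies from their mean sum to zero.
  suffices h : ((y i).1.1 k - D.average y i k)
      + ∑ j : {j // i ∈ S.nbr j}, ((y j).1.2 ⟨i, j.2⟩ k - D.average y i k) = 0 by
    rw [h, zero_dotProduct]
  rw [Finset.sum_sub_distrib, Finset.sum_const, Finset.card_univ]
  have hc : ((Fintype.card {j // i ∈ S.nbr j} : ℝ) + 1) • D.average y i
      = LocVar.own (y i) + ∑ j : {j // i ∈ S.nbr j}, LocVar.copy (y j) ⟨i, j.2⟩ := by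
    unfold average
    rw [smul_inv_smul₀]
    positivity
  have hk := congrFun hc k
  have hs : (∑ j : {j // i ∈ S.nbr j}, LocVar.copy (y j) ⟨i, j.2⟩ : D.Traj i) k
      = ∑ j : {j // i ∈ S.nbr j}, (y j).1.2 ⟨i, j.2⟩ k := by
    exact map_sum (LinearMap.proj (R := ℝ) (φ := fun _ => S.St i) k) (fun j : {j // i ∈ S.nbr j} =>
      (LocVar.copy (y j) ⟨i, j.2⟩ : D.Traj i)) Finset.univ
  rw [Pi.add_apply, hs] at hk
  simp only [Pi.smul_apply, add_smul, one_smul,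
    Nat.cast_smul_eq_nsmul, LocVar.own] at hk
  rw [sub_add_sub_comm]
  erw [← hk]
  rw [sub_eq_zero]
  abel

/-! ### Continuity and coercivity of the costs -/

theorem continuous_cost (i : Fin M) : Continuous (D.cost i) := by
  unfold cost stage Vf LocVar.own LocVar.copy LocVar.inp
  simp only [dotProduct, mulVec]
  fun_prop

theorem continuous_augForm : Continuous fun p : (∀ i, D.Aug i) × (∀ i, D.Aug i) =>
    D.augForm p.1 p.2 := by
  simp only [augForm_apply, augDot, dotProduct]
  fun_prop

theorem continuous_localObj (i : Fin M) (lam : D.Aug i) (z : ∀ i, D.Traj i) :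
    Continuous (D.localObj i lam z) := by
  have := D.continuous_cost i
  unfold localObj augDot
  simp only [dotProduct]
  fun_prop

theorem continuous_average : Continuous D.average := by
  unfold average LocVar.own LocVar.copy
  fun_prop

variable {D}

theorem CostAssumption.stage_ge (hcost : D.CostAssumption) (i : Fin M) (x : S.St i) (u : S.Inp i)
    (xn : ∀ j : S.nbr i, S.St j) : x ⬝ᵥ D.Q i *ᵥ x + u ⬝ᵥ D.R i *ᵥ u ≤ D.stage i x u xn :=
  le_add_of_nonneg_right
    (Finset.sum_nonneg fun j _ => (hcost.posSemidef_Qc i j).dotProduct_nonneg _)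

theorem CostAssumption.stage_nonneg (hcost : D.CostAssumption) (i : Fin M) (x : S.St i)
    (u : S.Inp i) (xn : ∀ j : S.nbr i, S.St j) : 0 ≤ D.stage i x u xn :=
  (add_nonneg ((hcost.posDef_Q i).posSemidef.dotProduct_nonneg x)
    ((hcost.posDef_R i).posSemidef.dotProduct_nonneg u)).trans (hcost.stage_ge i x u xn)

theorem CostAssumption.cost_nonneg (hcost : D.CostAssumption) (i : Fin M) (y : D.LocVar i) :
    0 ≤ D.cost i y :=
  add_nonneg (Finset.sum_nonneg fun _ _ => hcost.stage_nonneg i _ _ _)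
    ((hcost.posDef_Φ i).posSemidef.dotProduct_nonneg _)

theorem CostAssumption.totalForm_comm (hcost : D.CostAssumption) (y y' : D.Var) :
    D.totalForm y y' = D.totalForm y' y := by
  simp only [totalForm_apply, costForm_apply]
  refine Finset.sum_congr rfl fun i _ => ?_
  rw [(hcost.posDef_Φ i).1.dotProduct_comm]
  congr 1
  refine Finset.sum_congr rfl fun k _ => ?_
  rw [(hcost.posDef_Q i).1.dotProduct_comm, (hcost.posDef_R i).1.dotProduct_comm]
  congr 1
  exact Finset.sum_congr rfl fun j _ => (hcost.posSemidef_Qc i j).1.dotProduct_comm _ _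

theorem CostAssumption.totalForm_nonneg (hcost : D.CostAssumption) (y : D.Var) :
    0 ≤ D.totalForm y y := by
  rw [totalForm_self]
  exact Finset.sum_nonneg fun i _ => hcost.cost_nonneg i _

variable (D) in
/-- The states and inputs in a global decision variable, without the copies. -/
def ownInp (y : D.Var) : ∀ i, D.Traj i × D.InpSeq i := fun i => (LocVar.own (y i), LocVar.inp (y i))

/-- The total cost controls the states and inputs. -/
theorem CostAssumption.exists_mul_norm_ownInp_le (hcost : D.CostAssumption) :
    ∃ a > 0, ∀ y : D.Var, a * ‖D.ownInp y‖ ^ 2 ≤ ∑ i, D.cost i (y i) := by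
  -- The semidefinite coupling terms are dropped. States before the end of the horizon are
  -- controlled by `D.Q`, inputs by `D.R`, and the final state by `D.Φ`.
  let q : (∀ i, D.Traj i × D.InpSeq i) → ℝ := fun w => ∑ i,
    (∑ k : Fin D.N, ((w i).1 k.castSucc ⬝ᵥ D.Q i *ᵥ (w i).1 k.castSucc
      + (w i).2 k ⬝ᵥ D.R i *ᵥ (w i).2 k)
      + (w i).1 (Fin.last _) ⬝ᵥ D.Φ i *ᵥ (w i).1 (Fin.last _))
  have hQ := fun i x => (hcost.posDef_Q i).posSemidef.dotProduct_nonneg x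
  have hR := fun i x => (hcost.posDef_R i).posSemidef.dotProduct_nonneg x
  have hΦ := fun i x => (hcost.posDef_Φ i).posSemidef.dotProduct_nonneg x
  obtain ⟨a, ha, h⟩ := exists_mul_sq_norm_le (q := q) (by
      simp only [q, dotProduct, mulVec]
      fun_prop) (by
      intro t w
      simp only [q, Pi.smul_apply, Prod.smul_fst, Prod.smul_snd, mulVec_smul, smul_dotProduct,
        dotProduct_smul, smul_eq_mul, Finset.mul_sum, mul_add]
      refine Finset.sum_congr rfl fun i _ => ?_
      congr 1
      · exact Finset.sum_congr rfl fun k _ => by ring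
      · ring) (by
      intro w hw
      by_contra hneg
      apply hw
      have hnn : ∀ i k, 0 ≤ (w i).1 (Fin.castSucc k) ⬝ᵥ D.Q i *ᵥ (w i).1 k.castSucc
          + (w i).2 k ⬝ᵥ D.R i *ᵥ (w i).2 k := fun i k => add_nonneg (hQ _ _) (hR _ _)
      have hsn := fun i => Finset.sum_nonneg fun k (_ : k ∈ Finset.univ) => hnn i k
      have h0 : q w = 0 := le_antisymm (not_lt.1 hneg)
        (Finset.sum_nonneg fun i _ => add_nonneg (hsn i) (hΦ _ _))
      rw [Finset.sum_eq_zero_iff_of_nonneg fun i _ => add_nonneg (hsn i) (hΦ _ _)] at h0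
      funext i
      have hi := h0 i (Finset.mem_univ _)
      obtain ⟨h1, h2⟩ := (add_eq_zero_iff_of_nonneg (hsn i) (hΦ _ _)).1 hi
      rw [Finset.sum_eq_zero_iff_of_nonneg fun k _ => hnn i k] at h1
      have h3 := fun k => (add_eq_zero_iff_of_nonneg (hQ _ _) (hR _ _)).1 (h1 k (Finset.mem_univ k))
      refine Prod.ext (funext fun k => ?_) (funext fun k => ?_)
      · induction k using Fin.lastCases with
        | last => exact by_contra fun hne => ((hcost.posDef_Φ i).dotProduct_pos hne).ne' h2
        | cast k => exact by_contra fun hne => ((hcost.posDef_Q i).dotProduct_pos hne).ne' (h3 k).1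
      · exact by_contra fun hne => ((hcost.posDef_R i).dotProduct_pos hne).ne' (h3 k).2)
  refine ⟨a, ha, fun y => (h _).trans ?_⟩
  refine Finset.sum_le_sum fun i _ => add_le_add_left (Finset.sum_le_sum fun k _ => ?_) _
  exact hcost.stage_ge i _ _ _

/-- The local minimizations have quadratic growth. -/
theorem CostAssumption.exists_localObj_ge (hcost : D.CostAssumption) (i : Fin M) (lam : D.Aug i)
    (z : ∀ i, D.Traj i) :
    ∃ a > 0, ∃ w c, ∀ y, a * ‖y - w‖ ^ 2 + c ≤ D.localObj i lam z y := by
  -- The penalty makes the objective coercive in own states and copies alike; the inputs, which it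
  -- does not see, are covered by `D.R`.
  let q : D.LocVar i → ℝ := fun v => ∑ k, v.2 k ⬝ᵥ D.R i *ᵥ v.2 k + D.ρ / 2 * D.augDot v.1 v.1
  have hρ := D.ρ_pos
  have hR := fun x => (hcost.posDef_R i).posSemidef.dotProduct_nonneg x
  obtain ⟨a, ha, h⟩ := exists_mul_sq_norm_le (q := q) (by
      simp only [q, augDot, dotProduct, mulVec]
      fun_prop) (by
      intro t v
      simp only [q, augDot, Pi.smul_apply, Prod.smul_fst, Prod.smul_snd, mulVec_smul,
        smul_dotProduct, dotProduct_smul, smul_eq_mul, ← Finset.mul_sum]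
      ring) (by
      intro v hv
      by_contra hneg
      apply hv
      have h1 := Finset.sum_nonneg fun k (_ : k ∈ Finset.univ) => hR (v.2 k)
      have h2 := D.augDot_self_nonneg v.1
      have h3 : 0 ≤ D.ρ / 2 * D.augDot v.1 v.1 := by positivity
      simp only [q, not_lt] at hneg
      have h4 : ∑ k, v.2 k ⬝ᵥ D.R i *ᵥ v.2 k = 0 := by linarith
      have h5 : D.augDot v.1 v.1 ≤ 0 := by
        by_contra hc
        push Not at hc
        have : 0 < D.ρ / 2 * D.augDot v.1 v.1 := by positivity
        linarith
      rw [Finset.sum_eq_zero_iff_of_nonneg fun k _ => hR _] at h4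
      refine Prod.ext (D.eq_zero_of_augDot_self h5) (funext fun k => ?_)
      exact by_contra fun hne =>
        ((hcost.posDef_R i).dotProduct_pos hne).ne' (h4 k (Finset.mem_univ k)))
  -- Completing the square absorbs the linear multiplier term into a shift of the centre by `ρ⁻¹ •
  -- l`.
  have hsq : ∀ (b l : D.Aug i), D.augDot l b + D.ρ / 2 * D.augDot b b
      = D.ρ / 2 * D.augDot (b + D.ρ⁻¹ • l) (b + D.ρ⁻¹ • l) - D.ρ⁻¹ / 2 * D.augDot l l := by
    intro b l
    have hc := D.augDot_comm b l
    have e : D.augDot (b + D.ρ⁻¹ • l) (b + D.ρ⁻¹ • l)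
        = D.augDot b b + D.ρ⁻¹ * D.augDot b l + D.ρ⁻¹ * D.augDot l b
          + D.ρ⁻¹ * D.ρ⁻¹ * D.augDot l l := by
      simp only [augDot, Pi.smul_apply, Prod.smul_fst, Prod.smul_snd, Prod.fst_add, Prod.snd_add,
        Pi.add_apply, smul_dotProduct, dotProduct_smul, smul_eq_mul, add_dotProduct,
        dotProduct_add, Finset.sum_add_distrib, ← Finset.mul_sum]
      ring
    rw [e, hc]
    field_simp
    ring
  have hadd : ∀ l b c : D.Aug i, D.augDot l b = D.augDot l (b - c) + D.augDot l c := by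
    intro l b c
    simp only [augDot, Prod.fst_sub, Prod.snd_sub, Pi.sub_apply, dotProduct_sub,
      Finset.sum_sub_distrib]
    ring
  refine ⟨a, ha, (D.augOf z i - D.ρ⁻¹ • lam, 0),
    D.augDot lam (D.augOf z i) - D.ρ⁻¹ / 2 * D.augDot lam lam, fun y => ?_⟩
  have h1 := h (y - (D.augOf z i - D.ρ⁻¹ • lam, 0))
  have h2 : ∑ k, y.2 k ⬝ᵥ D.R i *ᵥ y.2 k ≤ D.cost i y := by
    refine le_add_of_le_of_nonneg (Finset.sum_le_sum fun k _ => ?_)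
      ((hcost.posDef_Φ i).posSemidef.dotProduct_nonneg _)
    exact (le_add_of_nonneg_left ((hcost.posDef_Q i).posSemidef.dotProduct_nonneg _)).trans
      (hcost.stage_ge i _ _ _)
  have h3 := hsq (y.1 - D.augOf z i) lam
  have h4 := hadd lam y.1 (D.augOf z i)
  simp only [q, Prod.fst_sub, Prod.snd_sub, sub_zero, ← sub_add] at h1
  unfold localObj
  linarith

end MPCDesign

end

noncomputable section

/-! ### Closedness of the constraint sets. -/

theorem IsPolyhedron.isClosed {n : ℕ} {T : Set (Fin n → ℝ)} (h : IsPolyhedron T) : IsClosed T := by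
  obtain ⟨q, G, g, rfl⟩ := h
  exact isClosed_le (continuous_const.matrix_mulVec continuous_id) continuous_const

theorem PWANetwork.isClosed_X {M : ℕ} (S : PWANetwork M) (i : Fin M) : IsClosed (S.X i) := by
  rw [← S.iUnion_P i]
  exact isClosed_iUnion_of_finite fun l => (S.isPolyhedron_P i l).isClosed

theorem isClosed_setOf_and {E : Type*} [TopologicalSpace E] {p q : E → Prop}
    (hp : IsClosed {y | p y}) (hq : IsClosed {y | q y}) : IsClosed {y | p y ∧ q y} :=
  hp.inter hq

theorem isClosed_setOf_forall {E ι : Type*} [TopologicalSpace E] {p : ι → E → Prop}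
    (h : ∀ k, IsClosed {y | p k y}) : IsClosed {y | ∀ k, p k y} := by
  convert isClosed_iInter h using 1
  ext y
  simp

namespace MPCDesign

variable {M : ℕ} {S : PWANetwork M} {D : MPCDesign S}

/-! ### Feasible sets -/

theorem isClosed_localSet (hterminal : D.TerminalAssumption) (i : Fin M) (xi : S.St i) :
    IsClosed (D.localSet i xi) := by
  unfold localSet LocVar.own LocVar.inp LocVar.copy
  refine isClosed_setOf_and (isClosed_setOf_forall fun k => ?_) <|
    isClosed_setOf_and (isClosed_setOf_forall fun k => ?_) <|
    isClosed_setOf_and (isClosed_setOf_forall fun k => ?_) <| isClosed_setOf_and ?_ ?_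
  · refine isClosed_le ?_ continuous_const
    unfold PWANetwork.h
    fun_prop
  · exact (S.isClosed_X i).preimage (by fun_prop : Continuous fun y : D.LocVar i => y.1.1 k)
  · exact (S.isClosed_U i).preimage (by fun_prop : Continuous fun y : D.LocVar i => y.2 k)
  · exact isClosed_eq (by fun_prop) continuous_const
  · exact (hterminal.isClosed i).preimage
      (by fun_prop : Continuous fun y : D.LocVar i => y.1.1 (Fin.last _))

theorem isClosed_switchSet (i : Fin M) (s : D.SwSeq i) : IsClosed (D.switchSet i s) := by
  unfold switchSet LocVar.own LocVar.inp LocVar.copy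
  refine isClosed_setOf_and (isClosed_setOf_forall fun k => ?_)
    (isClosed_setOf_forall fun k => ?_)
  · refine isClosed_eq (by fun_prop) ?_
    unfold PWANetwork.aff
    fun_prop
  · exact (S.isPolyhedron_P i _).isClosed.preimage
      (by fun_prop : Continuous fun y : D.LocVar i => y.1.1 k)

theorem aff_eq_f {i : Fin M} {l : Fin (S.L i)} {x : S.St i} (hx : x ∈ S.P i l) (u : S.Inp i)
    (xn : ∀ j : S.nbr i, S.St j) : S.aff i l x u xn = S.f i x u xn :=
  (S.f_eq i l x u xn hx).symm

theorem feasibleSw_subset (s : ∀ i, D.SwSeq i) (x : S.State) : D.feasibleSw s x ⊆ D.feasible x := by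
  rintro y ⟨hy, hc⟩
  refine ⟨fun i => (hy i).1, fun i k => ?_, hc⟩
  rw [(hy i).2.1 k, aff_eq_f ((hy i).2.2 _)]

theorem Consistent.copy_eq {y : D.Var} (h : D.Consistent y) (i : Fin M) (k : Fin (D.N + 1)) :
    (fun j : S.nbr i => LocVar.copy (y i) j k) = S.nbrState (fun i => LocVar.own (y i) k) i :=
  funext fun j => congrFun (h i j) k

/-! ### Invariants and limits of switching ADMM -/

variable {x : S.State} {u : ∀ i, D.InpSeq i} {s : ℕ → ∀ i, D.SwSeq i} {y : ℕ → D.Var}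
  {z : ℕ → ∀ i, D.Traj i} {lam : ℕ → ∀ i, D.Aug i}

/-- The local objectives add up to one augmented Lagrangian on the product space, so that the
parallel local minimizations can be analysed as a single ADMM step. -/
theorem sum_localObj (lam : ∀ i, D.Aug i) (z : ∀ i, D.Traj i) (y : D.Var) :
    ∑ i, D.localObj i (lam i) z (y i) = D.totalForm y y + D.augForm lam (D.augMap y)
      + D.ρ / 2 * D.augForm (D.augMap y - D.augOfMap z) (D.augMap y - D.augOfMap z) := by
  simp only [localObj, Finset.sum_add_distrib, totalForm_self, augForm_apply, Finset.mul_sum]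
  rfl

theorem IsSwADMM.lam_succ' (h : D.IsSwADMM x u s y z lam) (τ : ℕ) :
    lam (τ + 1) = lam τ + D.ρ • (D.augMap (y τ) - D.augOfMap (z (τ + 1))) :=
  funext fun i => h.lam_succ τ i

theorem IsSwADMM.z_succ' (h : D.IsSwADMM x u s y z lam) (τ : ℕ) :
    z (τ + 1) = D.average (y τ) := funext fun i => h.z_succ τ i

/-- The multipliers start at zero and every increment is a residual of an orthogonal projection onto
consensus. Hence the multiplier term disappears at consistent competitors. -/
theorem IsSwADMM.augForm_lam (h : D.IsSwADMM x u s y z lam) (τ : ℕ) :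
    ∀ w ∈ D.consensus, D.augForm (lam τ) w = 0 := by
  rintro _ ⟨w, rfl⟩
  induction τ with
  | zero => simp [h.lam_zero]
  | succ τ ih =>
    rw [h.lam_succ', map_add, LinearMap.add_apply, ih, map_smul, LinearMap.smul_apply, h.z_succ',
      D.augForm_sub_average, smul_zero, add_zero]

/-- Exhibits `lam τ / τ` as ρ times a Cesàro mean of residuals, whose limit is known once the
iterates converge. -/
theorem IsSwADMM.lam_eq_sum (h : D.IsSwADMM x u s y z lam) (τ : ℕ) :
    lam τ = D.ρ • ∑ k ∈ Finset.range τ, (D.augMap (y k) - D.augOfMap (z (k + 1))) := by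
  induction τ with
  | zero => simp [h.lam_zero]
  | succ τ ih => rw [h.lam_succ', ih, Finset.sum_range_succ, smul_add]

theorem IsSwADMM.switch_eq (h : D.IsSwADMM x u s y z lam) (τ : ℕ) :
    s (D.Tcut + τ) = s D.Tcut := by
  induction τ with
  | zero => rfl
  | succ τ ih => rw [← add_assoc, h.s_frozen _ (Nat.le_add_right _ _), ih]

/-- The constraint set is a product and the objective a sum over subsystems, so local minimizers
combine to a minimizer. -/
theorem IsSwADMM.isMinOn_sum (h : D.IsSwADMM x u s y z lam) (τ : ℕ) :
    IsMinOn (fun y => D.totalForm y y + D.augForm (lam τ) (D.augMap y)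
      + D.ρ / 2 * D.augForm (D.augMap y - D.augOfMap (z τ)) (D.augMap y - D.augOfMap (z τ)))
      {y | ∀ i, y i ∈ D.localSet i (x i) ∩ D.switchSet i (s τ i)} (y τ) := by
  intro w hw
  simp only [Set.mem_ofPred_eq, ← sum_localObj]
  exact Finset.sum_le_sum fun i _ => h.y_min τ i (hw i)

/-- If the local problems are feasible, so is the global one. -/
theorem CouplingAssumption.nonempty (hcoupling : D.CouplingAssumption) (hx : x ∈ D.X0)
    {s : ∀ i, D.SwSeq i} (h : ∀ i, (D.localSet i (x i) ∩ D.switchSet i (s i)).Nonempty) :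
    (D.feasibleSw s x).Nonempty := by
  by_contra hne
  exact hcoupling x hx ⟨s, Set.not_nonempty_iff_eq_empty.1 hne, h⟩

/-- The limit of switching ADMM is feasible for the final switching sequence. -/
theorem IsSwADMM.limit_mem (hcoupling : D.CouplingAssumption) (hterminal : D.TerminalAssumption)
    (hcost : D.CostAssumption) (hx : x ∈ D.X0) (h : D.IsSwADMM x u s y z lam) {y' : D.Var}
    (hlim : Tendsto y atTop (𝓝 y')) : y' ∈ D.feasibleSw (s D.Tcut) x := by
  have hmem : ∀ τ i, y (D.Tcut + τ) i ∈ D.localSet i (x i) ∩ D.switchSet i (s D.Tcut i) := by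
    intro τ i
    have := h.y_mem (D.Tcut + τ) i
    rwa [h.switch_eq] at this
  have hshift : Tendsto (fun τ => D.Tcut + τ) atTop atTop :=
    tendsto_atTop_mono (fun τ => Nat.le_add_left τ _) tendsto_id
  refine ⟨fun i => ?_, ?_⟩
  · exact ((isClosed_localSet hterminal i (x i)).inter (isClosed_switchSet i _)).mem_of_tendsto
      ((tendsto_pi_nhds.1 hlim i).comp hshift) (Eventually.of_forall fun τ => hmem τ i)
  -- The consistent point against which all later minimizations are compared.
  obtain ⟨w, hw, hwc⟩ := hcoupling.nonempty hx fun i => ⟨_, hmem 0 i⟩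
  have hw' := (D.augMap_mem_consensus_iff w).2 hwc
  have hcont : Continuous D.augMap := D.augMap.continuous_of_finiteDimensional
  have hcont' : Continuous D.augOfMap := D.augOfMap.continuous_of_finiteDimensional
  set r : ℕ → ∀ i, D.Aug i := fun τ => D.augMap (y τ) - D.augOfMap (D.average (y τ)) with hr
  set r' := D.augMap y' - D.augOfMap (D.average y') with hr'
  have hrlim : Tendsto r atTop (𝓝 r') :=
    ((hcont.sub (hcont'.comp D.continuous_average)).tendsto y').comp hlim
  -- If the limiting residual were nonzero, the multipliers would grow linearly in its direction.
  have hlam : Tendsto (fun τ : ℕ => (τ : ℝ)⁻¹ • lam τ) atTop (𝓝 (D.ρ • r')) := by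
    have h1 := hrlim.cesaro_smul.const_smul D.ρ
    refine h1.congr fun τ => ?_
    rw [h.lam_eq_sum, smul_comm]
    simp only [h.z_succ', hr]
  have hzlim : Tendsto z atTop (𝓝 (D.average y')) := by
    rw [← tendsto_add_atTop_iff_nat 1]
    exact ((D.continuous_average.tendsto y').comp hlim).congr fun τ => (h.z_succ' τ).symm
  set b : ℕ → ℝ := fun τ => D.totalForm w w
    + D.ρ / 2 * D.augForm (D.augMap w - D.augOfMap (z τ)) (D.augMap w - D.augOfMap (z τ)) with hb
  have hdiff : Tendsto (fun τ => D.augMap w - D.augOfMap (z τ)) atTop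
      (𝓝 (D.augMap w - D.augOfMap (D.average y'))) :=
    tendsto_const_nhds.sub ((hcont'.tendsto _).comp hzlim)
  have hblim := tendsto_const_nhds (x := D.totalForm w w) |>.add
    (((D.continuous_augForm.tendsto _).comp (hdiff.prodMk_nhds hdiff)).const_mul (D.ρ / 2))
  -- Minimality against `w`, where the multiplier term vanishes; the nonnegative cost and penalty of
  -- the iterate are discarded.
  have hbound : ∀ τ, D.augForm (lam (D.Tcut + τ)) (r (D.Tcut + τ)) ≤ b (D.Tcut + τ) := by
    intro τ
    have h1 := h.isMinOn_sum (D.Tcut + τ) (show w ∈ _ by rw [h.switch_eq]; exact hw)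
    simp only [Set.mem_ofPred_eq] at h1
    rw [h.augForm_lam _ _ hw'] at h1
    have h2 : D.augForm (lam (D.Tcut + τ)) (r (D.Tcut + τ))
        = D.augForm (lam (D.Tcut + τ)) (D.augMap (y (D.Tcut + τ))) := by
      rw [hr, map_sub, h.augForm_lam _ _ (D.augOfMap_mem _), sub_zero]
    have h3 := hcost.totalForm_nonneg (y (D.Tcut + τ))
    have h4 := mul_nonneg (half_pos D.ρ_pos).le (D.augForm_self_nonneg
      (D.augMap (y (D.Tcut + τ)) - D.augOfMap (z (D.Tcut + τ))))
    rw [h2]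
    simp only [hb]
    linarith
  have hl := ((D.continuous_augForm.tendsto (D.ρ • r', r')).comp
    (hlam.prodMk_nhds hrlim)).comp hshift
  have hr0 : Tendsto (fun τ : ℕ => (τ : ℝ)⁻¹ * b τ) atTop (𝓝 (0 * _)) :=
    (tendsto_inv_atTop_nhds_zero_nat (𝕜 := ℝ)).mul hblim
  rw [zero_mul] at hr0
  -- After division by the iteration number the left side tends to `ρ` times the squared norm of
  -- `r'`, and the right side, whose numerator converges, to zero.
  have hle := le_of_tendsto_of_tendsto' hl (hr0.comp hshift) fun τ => by
    simp only [Function.comp_apply, map_smul, LinearMap.smul_apply, smul_eq_mul]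
    exact mul_le_mul_of_nonneg_left (hbound τ) (by positivity)
  rw [map_smul, LinearMap.smul_apply, smul_eq_mul] at hle
  have hr'0 : r' = 0 :=
    D.eq_zero_of_augForm_self (le_of_mul_le_mul_left (by simpa using hle) D.ρ_pos)
  rw [← augMap_mem_consensus_iff, sub_eq_zero.1 hr'0]
  exact D.augOfMap_mem _

/-- Plans are feasible, and not worse than a feasible roll-out of the guess. -/
theorem IsPlan.feasible_and_cost_le (hcoupling : D.CouplingAssumption)
    (hterminal : D.TerminalAssumption) (hcost : D.CostAssumption) (hx : x ∈ D.X0) {y : D.Var}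
    (h : D.IsPlan x u y) : y ∈ D.feasible x ∧
      (D.rollout x u ∈ D.feasible x → ∀ i, D.cost i (y i) ≤ D.cost i (D.rollout x u i)) := by
  obtain ⟨y', ⟨s, yy, z, lam, hrun, hlim⟩, rfl⟩ := h
  have hy' := feasibleSw_subset _ _ (hrun.limit_mem hcoupling hterminal hcost hx hlim)
  split_ifs with hif
  · exact ⟨hif.1, fun _ _ => le_rfl⟩
  · refine ⟨hy', fun hr => ?_⟩
    by_contra hn
    exact hif ⟨hr, hn⟩

end MPCDesign

end

noncomputable section

namespace MPCDesign

variable {M : ℕ} {S : PWANetwork M} {D : MPCDesign S}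

/-! ### Recursive feasibility -/

variable (D) in
/-- Total stage cost of the network. -/
def totalStage (x : S.State) (u : S.Input) : ℝ := ∑ i, D.stage i (x i) (u i) (S.nbrState x i)

variable (D) in
/-- Total terminal cost of the network. -/
def totalVf (x : S.State) : ℝ := ∑ i, D.Vf i (x i)

variable (D) in
/-- The predicted global state at stage `k` (zero after the horizon). -/
def stateAt (y : D.Var) (k : ℕ) : S.State :=
  fun i => if hk : k < D.N + 1 then LocVar.own (y i) ⟨k, hk⟩ else 0

variable (D) in
/-- The predicted global input at stage `k` (zero after the horizon). -/
def inputAt (y : D.Var) (k : ℕ) : S.Input :=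
  fun i => if hk : k < D.N then LocVar.inp (y i) ⟨k, hk⟩ else 0

theorem stateAt_fin (y : D.Var) (k : Fin (D.N + 1)) :
    D.stateAt y k = fun i => LocVar.own (y i) k := by
  funext i
  exact dif_pos k.2

theorem inputAt_fin (y : D.Var) (k : Fin D.N) : D.inputAt y k = fun i => LocVar.inp (y i) k := by
  funext i
  simp [inputAt]

theorem stateAt_rollout (x : S.State) (u : ∀ i, D.InpSeq i) {k : ℕ} (hk : k < D.N + 1) :
    D.stateAt (D.rollout x u) k = D.roll x u k := by
  funext i
  simp [stateAt, hk, rollout, LocVar.own]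

/-- Agreement of the copies turns the local costs into network costs stage by stage, the form in
which the decrease assumption, a statement about the sum over subsystems, applies. -/
theorem Consistent.sum_cost {y : D.Var} (h : D.Consistent y) : ∑ i, D.cost i (y i)
    = ∑ k ∈ Finset.range D.N, D.totalStage (D.stateAt y k) (D.inputAt y k)
      + D.totalVf (D.stateAt y D.N) := by
  have hlast : D.stateAt y D.N = fun i => LocVar.own (y i) (Fin.last D.N) :=
    stateAt_fin y (Fin.last D.N)
  rw [← Fin.sum_univ_eq_sum_range (fun k => D.totalStage (D.stateAt y k) (D.inputAt y k)), hlast]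
  simp only [cost, Finset.sum_add_distrib, totalVf, totalStage]
  rw [Finset.sum_comm]
  congr 1
  refine Finset.sum_congr rfl fun k _ => Finset.sum_congr rfl fun i _ => ?_
  have h1 := stateAt_fin y k.castSucc
  rw [Fin.val_castSucc] at h1
  rw [h1, inputAt_fin, h.copy_eq]

theorem consistent_rollout (x : S.State) (u : ∀ i, D.InpSeq i) : D.Consistent (D.rollout x u) :=
  fun _ _ => rfl

theorem rollout_dynamics (x : S.State) (u : ∀ i, D.InpSeq i) (i : Fin M) (k : Fin D.N) :
    LocVar.own (D.rollout x u i) k.succ = S.f i (LocVar.own (D.rollout x u i) k.castSucc)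
      (LocVar.inp (D.rollout x u i) k) (fun j => LocVar.copy (D.rollout x u i) j k.castSucc) := by
  simp only [rollout, LocVar.own, LocVar.inp, LocVar.copy, Fin.val_succ, Fin.val_castSucc, roll,
    PWANetwork.next, k.2, dif_pos]
  rfl

theorem stateAt_zero_of_feasible {x : S.State} {y : D.Var} (hy : y ∈ D.feasible x) :
    D.stateAt y 0 = x := by
  funext i
  have := (hy.1 i).2.2.2.1
  simpa [stateAt] using this

theorem stateAt_succ_of_feasible {x : S.State} {y : D.Var} (hy : y ∈ D.feasible x) {k : ℕ}
    (hk : k < D.N) : D.stateAt y (k + 1) = S.next (D.stateAt y k) (D.inputAt y k) := by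
  funext i
  have h1 := hy.2.1 i ⟨k, hk⟩
  rw [hy.2.2.copy_eq] at h1
  have e1 := stateAt_fin y (Fin.succ ⟨k, hk⟩)
  have e2 := stateAt_fin y (Fin.castSucc ⟨k, hk⟩)
  have e3 := inputAt_fin y ⟨k, hk⟩
  simp only [Fin.val_succ, Fin.val_castSucc] at e1 e2 e3
  rw [e1, e2, e3]
  exact h1

theorem h_stateAt_of_feasible {x : S.State} {y : D.Var} (hy : y ∈ D.feasible x) {k : ℕ}
    (hk : k < D.N + 1) (i : Fin M) :
    S.h i (D.stateAt y k i) (S.nbrState (D.stateAt y k) i) ≤ 0 := by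
  have h1 := (hy.1 i).1 ⟨k, hk⟩
  rw [hy.2.2.copy_eq] at h1
  rwa [stateAt_fin y ⟨k, hk⟩]

theorem stateAt_mem_X {x : S.State} {y : D.Var} (hy : y ∈ D.feasible x) {k : ℕ}
    (hk : k < D.N + 1) (i : Fin M) : D.stateAt y k i ∈ S.X i := by
  rw [stateAt_fin y ⟨k, hk⟩]
  exact (hy.1 i).2.1 _

theorem stateAt_last_mem {x : S.State} {y : D.Var} (hy : y ∈ D.feasible x) :
    D.stateAt y D.N ∈ D.XTglobal := by
  rw [show D.stateAt y D.N = _ from stateAt_fin y (Fin.last D.N)]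
  exact fun i => (hy.1 i).2.2.2.2

theorem TerminalAssumption.subset_X (hterminal : D.TerminalAssumption) (i : Fin M) :
    D.XT i ⊆ S.X i := by
  intro x hx
  rw [← S.iUnion_P i]
  obtain ⟨l, _, hl⟩ := Set.mem_iUnion₂.1 (hterminal.subset i hx)
  exact Set.mem_iUnion.2 ⟨l, hl⟩

theorem TerminalAssumption.next_mem (hterminal : D.TerminalAssumption) {x : S.State}
    (hx : x ∈ D.XTglobal) {l : ∀ i, Fin (S.L i)} (hl : ∀ i, x i ∈ S.P i (l i)) :
    S.next x (fun i => D.K i (l i) *ᵥ x i) ∈ D.XTglobal :=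
  fun i => hterminal.invariant i _ (hx i) _ (hl i) _ fun j => hx j

theorem CostAssumption.totalVf_next_le (hcost : D.CostAssumption) {x : S.State}
    (hx : x ∈ D.XTglobal) {l : ∀ i, Fin (S.L i)} (hl : ∀ i, x i ∈ S.P i (l i)) :
    D.totalVf (S.next x (fun i => D.K i (l i) *ᵥ x i))
      + D.totalStage x (fun i => D.K i (l i) *ᵥ x i) ≤ D.totalVf x := by
  have := hcost.decrease x hx l hl
  rw [Finset.sum_add_distrib, Finset.sum_sub_distrib] at this
  unfold totalVf totalStage PWANetwork.next
  linarith

/-- Shifting a feasible plan gives a feasible roll-out from the next state, and the cost drops at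
least by the stage cost of the current state. -/
theorem IsShiftedGuess.rollout_feasible (hterminal : D.TerminalAssumption)
    (hcost : D.CostAssumption) {x : S.State} {y : D.Var} {u : ∀ i, D.InpSeq i}
    (hu : D.IsShiftedGuess y u) (hy : y ∈ D.feasible x) :
    D.rollout (S.next x (D.inputAt y 0)) u ∈ D.feasible (S.next x (D.inputAt y 0)) ∧
      ∑ i, D.cost i (D.rollout (S.next x (D.inputAt y 0)) u i)
        + D.totalStage x (D.inputAt y 0) ≤ ∑ i, D.cost i (y i) := by
  choose l hl hul using hu
  -- Here `n` is the last input index `N - 1`, where the terminal controller replaces the shifted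
  -- input.
  obtain ⟨n, hn⟩ := Nat.exists_eq_succ_of_ne_zero D.N_pos.ne'
  have hx0 := stateAt_zero_of_feasible hy
  set x' := S.next x (D.inputAt y 0) with hx'
  have hlast : D.stateAt y D.N = fun i => LocVar.own (y i) (Fin.last D.N) :=
    stateAt_fin y (Fin.last D.N)
  have hl' : ∀ i, D.stateAt y D.N i ∈ S.P i (l i) := by
    rw [hlast]; exact hl
  have hinp : ∀ k, k + 1 < D.N →
      (fun i => if hk : k < D.N then u i ⟨k, hk⟩ else 0) = D.inputAt y (k + 1) := by
    intro k hk
    funext i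
    rw [dif_pos (by lia), hul i]
    simp [inputAt, hk]
  have hinp' : (fun i => if hk : n < D.N then u i ⟨n, hk⟩ else 0)
      = fun i => D.K i (l i) *ᵥ D.stateAt y D.N i := by
    funext i
    rw [dif_pos (by lia), hul i, hlast]
    simp [hn]
  -- Up to stage `N - 1` the roll-out retraces the old prediction, one stage later; only its final
  -- state is new.
  have hroll : ∀ k, k < D.N → D.roll x' u k = D.stateAt y (k + 1) := by
    intro k
    induction k with
    | zero => intro hk; rw [stateAt_succ_of_feasible hy hk, hx0]; rfl
    | succ k ih =>
      intro hk
      rw [roll, ih (by lia), hinp k hk, stateAt_succ_of_feasible hy hk]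
  have hrollN : D.roll x' u D.N
      = S.next (D.stateAt y D.N) (fun i => D.K i (l i) *ᵥ D.stateAt y D.N i) := by
    rw [← hinp']
    nth_rw 1 [hn]
    rw [Nat.succ_eq_add_one, roll, hroll n (by lia), ← Nat.succ_eq_add_one, ← hn]
  have hT := stateAt_last_mem hy
  have hnextT := hterminal.next_mem hT hl'
  have hh : ∀ k, k < D.N + 1 → ∀ i, S.h i (D.roll x' u k i) (S.nbrState (D.roll x' u k) i) ≤ 0 := by
    intro k hk
    rcases Nat.lt_succ_iff_lt_or_eq.1 hk with hk | rfl
    · rw [hroll k hk]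
      exact h_stateAt_of_feasible hy (by lia)
    · rw [hrollN]
      exact hterminal.coupled _ hT (h_stateAt_of_feasible hy (by lia)) l hl'
  have hX : ∀ k, k < D.N + 1 → ∀ i, D.roll x' u k i ∈ S.X i := by
    intro k hk
    rcases Nat.lt_succ_iff_lt_or_eq.1 hk with hk | rfl
    · rw [hroll k hk]
      exact stateAt_mem_X hy (by lia)
    · rw [hrollN]
      exact fun i => hterminal.subset_X i (hnextT i)
  have hU : ∀ i (k : Fin D.N), u i k ∈ S.U i := by
    intro i k
    rw [hul i]
    dsimp only
    split_ifs with hk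
    · exact (hy.1 i).2.2.1 _
    · exact hterminal.input_mem i _ ((hy.1 i).2.2.2.2) _ (hl i)
  refine ⟨⟨fun i => ⟨fun k => hh k k.2 i, fun k => hX k k.2 i, fun k => hU i k, rfl, ?_⟩,
    rollout_dynamics _ _, consistent_rollout _ _⟩, ?_⟩
  · have : D.roll x' u D.N i ∈ D.XT i := by rw [hrollN]; exact hnextT i
    exact this
  · rw [(consistent_rollout x' u).sum_cost, hy.2.2.sum_cost,
      stateAt_rollout _ _ (Nat.lt_succ_self _), hrollN]
    have h1 := hcost.totalVf_next_le hT hl'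
    -- The two cost sums share the old stages 1 to `N - 1`. The old one has in addition the current
    -- stage, the new one the terminal controller's stage, which is paid for by the decrease of the
    -- terminal cost.
    have e1 : ∑ k ∈ Finset.range D.N,
        D.totalStage (D.stateAt (D.rollout x' u) k) (D.inputAt (D.rollout x' u) k)
        = ∑ k ∈ Finset.range n, D.totalStage (D.stateAt y (k + 1)) (D.inputAt y (k + 1))
          + D.totalStage (D.stateAt y D.N) (fun i => D.K i (l i) *ᵥ D.stateAt y D.N i) := by
      rw [hn, Nat.succ_eq_add_one, Finset.sum_range_succ, ← Nat.succ_eq_add_one, ← hn, ← hinp',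
        stateAt_rollout _ _ (by lia), hroll n (by lia), ← Nat.succ_eq_add_one, ← hn]
      congr 1
      refine Finset.sum_congr rfl fun k hk => ?_
      have hk := Finset.mem_range.1 hk
      rw [stateAt_rollout _ _ (by lia), hroll k (by lia), ← hinp k (by lia)]
      rfl
    have e2 : ∑ k ∈ Finset.range D.N, D.totalStage (D.stateAt y k) (D.inputAt y k)
        = ∑ k ∈ Finset.range n, D.totalStage (D.stateAt y (k + 1)) (D.inputAt y (k + 1))
          + D.totalStage x (D.inputAt y 0) := by
      rw [hn, Finset.sum_range_succ', hx0]
    rw [e1, e2]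
    linarith

/-! ### Exponential decay -/

variable (D) in
theorem continuous_totalVf : Continuous D.totalVf := by
  unfold totalVf Vf
  simp only [dotProduct, mulVec]
  fun_prop

variable (D) in
theorem totalVf_smul (t : ℝ) (x : S.State) : D.totalVf (t • x) = t ^ 2 * D.totalVf x := by
  simp only [totalVf, Vf, Pi.smul_apply, mulVec_smul, smul_dotProduct, dotProduct_smul,
    smul_eq_mul, Finset.mul_sum]
  exact Finset.sum_congr rfl fun i _ => by ring

theorem sum_quadratic_pos {Q : ∀ i, Matrix (Fin (S.n i)) (Fin (S.n i)) ℝ} (hQ : ∀ i, (Q i).PosDef)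
    {x : S.State} (hx : x ≠ 0) : 0 < ∑ i, x i ⬝ᵥ Q i *ᵥ x i := by
  obtain ⟨i, hi⟩ := Function.ne_iff.1 hx
  exact Finset.sum_pos' (fun j _ => (hQ j).posSemidef.dotProduct_nonneg _)
    ⟨i, Finset.mem_univ _, (hQ i).dotProduct_pos hi⟩

/-- The state weights alone give the bound, hence its uniformity in the input. -/
theorem CostAssumption.exists_mul_norm_le_totalStage (hcost : D.CostAssumption) :
    ∃ a > 0, ∀ x u, a * ‖x‖ ^ 2 ≤ D.totalStage x u := by
  obtain ⟨a, ha, h⟩ := exists_mul_sq_norm_le (E := S.State) (q := fun x => ∑ i, x i ⬝ᵥ D.Q i *ᵥ x i)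
    (by simp only [dotProduct, mulVec]; fun_prop)
    (fun t x => by
      simp only [Pi.smul_apply, mulVec_smul, smul_dotProduct, dotProduct_smul, smul_eq_mul,
        Finset.mul_sum]
      exact Finset.sum_congr rfl fun i _ => by ring)
    fun x hx => sum_quadratic_pos hcost.posDef_Q hx
  refine ⟨a, ha, fun x u => (h x).trans (Finset.sum_le_sum fun i _ => ?_)⟩
  exact (le_add_of_nonneg_right ((hcost.posDef_R i).posSemidef.dotProduct_nonneg _)).trans
    (hcost.stage_ge i _ _ _)

/-- A radius small enough for all of the finitely many subsystems. It is also used in the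
contrapositive: admissible states outside the terminal set are bounded away from the origin. -/
theorem TerminalAssumption.exists_ball_subset (hterminal : D.TerminalAssumption) :
    ∃ δ > 0, ∀ x : S.State, (∀ i, x i ∈ S.X i) → ‖x‖ < δ → x ∈ D.XTglobal := by
  have h : ∀ i, ∀ᶠ ε in 𝓝[>] (0 : ℝ), Metric.ball 0 ε ∩ S.X i ⊆ D.XT i := by
    intro i
    obtain ⟨ε, hε, hsub⟩ := Metric.mem_nhdsWithin_iff.1 (hterminal.mem_nhdsWithin i)
    filter_upwards [Ioo_mem_nhdsGT hε] with ε' hε'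
    exact (Set.inter_subset_inter_left _ (Metric.ball_subset_ball hε'.2.le)).trans hsub
  obtain ⟨δ, hδ, hδ0⟩ := ((eventually_all.2 h).and self_mem_nhdsWithin).exists
  refine ⟨δ, hδ0, fun x hx hn i => hδ i ⟨?_, hx i⟩⟩
  rw [mem_ball_zero_iff]
  exact (norm_le_pi_norm x i).trans_lt hn

theorem Step.terminal {u0 : ∀ i, D.InpSeq i} {σ σ' : D.LoopState} (h : D.Step u0 σ σ')
    (hσ : σ.1 ∈ D.XTglobal) : ∃ l : ∀ i, Fin (S.L i), (∀ i, σ.1 i ∈ S.P i (l i)) ∧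
      σ'.1 = S.next σ.1 (fun i => D.K i (l i) *ᵥ σ.1 i) := by
  rcases h with h | h
  · exact h.2.2
  · exact absurd hσ h.1

/-- Uniform exponential decay after the terminal set has been reached. -/
theorem exists_terminal_decay (hterminal : D.TerminalAssumption) (hcost : D.CostAssumption) :
    ∃ γ : ℝ, 0 < γ ∧ γ < 1 ∧ ∃ C : ℝ, 1 ≤ C ∧ ∀ u0 (σ : ℕ → D.LoopState),
      (∀ t, D.Step u0 (σ t) (σ (t + 1))) → ∀ T, (σ T).1 ∈ D.XTglobal →
        ∀ t, ‖(σ (T + t)).1‖ ≤ C * γ ^ t * ‖(σ T).1‖ := by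
  obtain ⟨a, ha, hstage⟩ := hcost.exists_mul_norm_le_totalStage
  obtain ⟨a', ha', hVl⟩ := exists_mul_sq_norm_le D.continuous_totalVf D.totalVf_smul
    fun x hx => sum_quadratic_pos hcost.posDef_Φ hx
  obtain ⟨b₀, hb₀, hVu₀⟩ := exists_le_mul_sq_norm D.continuous_totalVf D.totalVf_smul
  -- The upper constant is enlarged so that `a < b`, which makes `κ` positive, and `a' ≤ b`, which
  -- makes the final constant at least one.
  set b := b₀ + 2 * a + a' with hb
  have hbpos : 0 < b := by positivity
  have hVu : ∀ x, D.totalVf x ≤ b * ‖x‖ ^ 2 := fun x => (hVu₀ x).trans (by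
    have := sq_nonneg ‖x‖
    rw [hb]; gcongr; linarith)
  set κ := 1 - a / b with hκ
  have hκ1 : κ < 1 := by rw [hκ]; linarith [div_pos ha hbpos]
  have hκ0 : 0 < κ := by
    rw [hκ, sub_pos, div_lt_one hbpos]
    linarith
  refine ⟨√κ, Real.sqrt_pos.2 hκ0, by rwa [Real.sqrt_lt' one_pos, one_pow], √(b / a'), ?_, ?_⟩
  · rw [Real.one_le_sqrt, one_le_div ha']
    linarith
  intro u0 σ hσ T hT t
  have hmem : ∀ t, (σ (T + t)).1 ∈ D.XTglobal := by
    intro t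
    induction t with
    | zero => exact hT
    | succ t ih =>
      obtain ⟨l, hl, he⟩ := (hσ (T + t)).terminal ih
      rw [← add_assoc, he]
      exact hterminal.next_mem ih hl
  have hdec : ∀ t, D.totalVf (σ (T + t)).1 ≤ κ ^ t * D.totalVf (σ T).1 := by
    intro t
    induction t with
    | zero => simp
    | succ t ih =>
      obtain ⟨l, hl, he⟩ := (hσ (T + t)).terminal (hmem t)
      have h1 := hcost.totalVf_next_le (hmem t) hl
      rw [← he] at h1
      have h2 := hstage (σ (T + t)).1 (fun i => D.K i (l i) *ᵥ (σ (T + t)).1 i)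
      have h3 : a / b * D.totalVf (σ (T + t)).1 ≤ a * ‖(σ (T + t)).1‖ ^ 2 := by
        rw [div_mul_eq_mul_div, div_le_iff₀ hbpos]
        nlinarith [hVu (σ (T + t)).1]
      have h4 : D.totalVf (σ (T + t + 1)).1 ≤ κ * D.totalVf (σ (T + t)).1 := by
        rw [hκ, sub_mul, one_mul]; linarith
      rw [← add_assoc, pow_succ, mul_comm _ κ, mul_assoc]
      exact h4.trans (mul_le_mul_of_nonneg_left ih hκ0.le)
  -- The terminal cost is comparable to the squared norm, so rate and constant are square roots.
  refine abs_le_of_sq_le_sq' ?_ (by positivity) |>.2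
  rw [mul_pow, mul_pow, ← pow_mul, mul_comm t 2, pow_mul, Real.sq_sqrt hκ0.le,
    Real.sq_sqrt (by positivity)]
  have h1 := (hVl _).trans ((hdec t).trans (mul_le_mul_of_nonneg_left (hVu _) (by positivity)))
  rw [div_mul_eq_mul_div, div_mul_eq_mul_div, le_div_iff₀ ha']
  linarith

/-! ### The closed loop -/

/-- The network state is the successor of a state for which the stored plan was feasible. -/
def Tracks (σ : D.LoopState) : Prop :=
  ∃ x y, σ.2 = some y ∧ y ∈ D.feasible x ∧ σ.1 = S.next x (D.inputAt y 0)

theorem inputAt_zero (y : D.Var) :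
    D.inputAt y 0 = fun i => LocVar.inp (y i) ⟨0, D.N_pos⟩ := by
  funext i
  simp [inputAt, D.N_pos]

theorem exists_shiftedGuess {x : S.State}
    {y : D.Var} (hy : y ∈ D.feasible x) : ∃ u, D.IsShiftedGuess y u := by
  have h : ∀ i, ∃ l, LocVar.own (y i) (Fin.last D.N) ∈ S.P i l := fun i => by
    have := (hy.1 i).2.1 (Fin.last D.N)
    rwa [← S.iUnion_P i, Set.mem_iUnion] at this
  choose l hl using h
  exact ⟨_, fun i => ⟨l i, hl i, rfl⟩⟩

/-- Recursive feasibility: the roll-out of the shifted plan is the witness. -/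
theorem Tracks.mem_X0 (hterminal : D.TerminalAssumption) (hcost : D.CostAssumption)
    {σ : D.LoopState} (h : Tracks σ) : σ.1 ∈ D.X0 := by
  obtain ⟨x, y, -, hy, he⟩ := h
  obtain ⟨u, hu⟩ := exists_shiftedGuess hy
  rw [he]
  exact ⟨_, (hu.rollout_feasible hterminal hcost hy).1⟩

/-- A step in MPC mode from a feasible state. -/
theorem Step.mpc (hcoupling : D.CouplingAssumption) (hterminal : D.TerminalAssumption)
    (hcost : D.CostAssumption) {u0 : ∀ i, D.InpSeq i} {σ σ' : D.LoopState} (h : D.Step u0 σ σ')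
    (hσ : σ.1 ∉ D.XTglobal) (hX0 : σ.1 ∈ D.X0) :
    ∃ u y, D.IsGuess u0 σ.2 u ∧ σ'.2 = some y ∧ y ∈ D.feasible σ.1 ∧
      σ'.1 = S.next σ.1 (D.inputAt y 0) ∧ (D.rollout σ.1 u ∈ D.feasible σ.1 →
        ∑ i, D.cost i (y i) ≤ ∑ i, D.cost i (D.rollout σ.1 u i)) := by
  rcases h with h | ⟨-, u, y, hg, hp, h2, h1⟩
  · exact absurd h.1 hσ
  · obtain ⟨hy, hc⟩ := hp.feasible_and_cost_le hcoupling hterminal hcost hX0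
    exact ⟨u, y, hg, h2, hy, by rw [h1, inputAt_zero],
      fun hr => Finset.sum_le_sum fun i _ => hc hr i⟩

/-- Before the terminal set is reached, the cost of the plans decreases linearly. -/
theorem IsClosedLoop.cost_le (hcoupling : D.CouplingAssumption) (hterminal : D.TerminalAssumption)
    (hcost : D.CostAssumption) {η : ℝ}
    (hη : ∀ x u, (∀ i, x i ∈ S.X i) → x ∉ D.XTglobal → η ≤ D.totalStage x u)
    {x0 u0} {σ : ℕ → D.LoopState} (hx0 : x0 ∈ D.X0) (hσ : D.IsClosedLoop x0 u0 σ) {J : ℝ}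
    (hJ : ∀ y, (σ 1).2 = some y → ∑ i, D.cost i (y i) ≤ J) (t : ℕ)
    (ht : ∀ k ≤ t, (σ k).1 ∉ D.XTglobal) :
    ∃ y, (σ (t + 1)).2 = some y ∧ y ∈ D.feasible (σ t).1 ∧
      (σ (t + 1)).1 = S.next (σ t).1 (D.inputAt y 0) ∧ ∑ i, D.cost i (y i) ≤ J - t * η := by
  induction t with
  | zero =>
    obtain ⟨u, y, -, h2, hy, h1, -⟩ := (hσ.2 0).mpc hcoupling hterminal hcost (ht 0 le_rfl)
      (by rw [hσ.1]; exact hx0)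
    exact ⟨y, h2, hy, h1, by simpa using hJ y h2⟩
  | succ t ih =>
    obtain ⟨y, h2, hy, h1, hc⟩ := ih fun k hk => ht k (by lia)
    have hX0 : (σ (t + 1)).1 ∈ D.X0 := Tracks.mem_X0 hterminal hcost ⟨_, y, h2, hy, h1⟩
    obtain ⟨u', y', hg, h2', hy', h1', hc'⟩ :=
      (hσ.2 (t + 1)).mpc hcoupling hterminal hcost (ht _ le_rfl) hX0
    refine ⟨y', h2', hy', h1', ?_⟩
    rw [h2] at hg
    -- The shifted roll-out is feasible at the new state, so the acceptance test applies to it and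
    -- the new plan inherits its cost drop.
    have hs := IsShiftedGuess.rollout_feasible hterminal hcost hg hy
    rw [← h1] at hs
    have h3 := hc' hs.1
    have h4 := hη (σ t).1 (D.inputAt y 0) (by
      have := stateAt_mem_X hy (k := 0) (by lia)
      rwa [stateAt_zero_of_feasible hy] at this) (ht t (by lia))
    push_cast
    linarith [hs.2]

theorem norm_stateAt_le (y : D.Var) (k : ℕ) : ‖D.stateAt y k‖ ≤ ‖D.ownInp y‖ := by
  rw [pi_norm_le_iff_of_nonneg (norm_nonneg _)]
  intro i
  unfold stateAt
  split_ifs with hk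
  · exact (norm_le_pi_norm (LocVar.own (y i)) ⟨k, hk⟩).trans
      ((norm_fst_le (D.ownInp y i)).trans (norm_le_pi_norm (D.ownInp y) i))
  · simp

/-- Trajectories that start outside the terminal set with a first plan of bounded cost decay
exponentially, with a constant that depends on the bound only. -/
theorem exists_decay_of_cost_le (hcoupling : D.CouplingAssumption)
    (hterminal : D.TerminalAssumption) (hcost : D.CostAssumption) {γ C : ℝ} (hγ0 : 0 < γ)
    (hγ1 : γ < 1) (hC : 1 ≤ C)
    (hdecay : ∀ u0 (σ : ℕ → D.LoopState), (∀ t, D.Step u0 (σ t) (σ (t + 1))) → ∀ T,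
      (σ T).1 ∈ D.XTglobal → ∀ t, ‖(σ (T + t)).1‖ ≤ C * γ ^ t * ‖(σ T).1‖) (J : ℝ) :
    ∃ C' : ℝ, ∀ x0 u0 σ, x0 ∈ D.X0 → D.IsClosedLoop x0 u0 σ → x0 ∉ D.XTglobal →
      (∀ y, (σ 1).2 = some y → ∑ i, D.cost i (y i) ≤ J) →
        ∀ t, ‖(σ t).1‖ ≤ C' * γ ^ t * ‖x0‖ := by
  obtain ⟨a, ha, hstage⟩ := hcost.exists_mul_norm_le_totalStage
  obtain ⟨a', ha', hown⟩ := hcost.exists_mul_norm_ownInp_le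
  obtain ⟨δ, hδ, hball⟩ := hterminal.exists_ball_subset
  have hη0 : 0 < a * δ ^ 2 := by positivity
  have hη : ∀ x u, (∀ i, x i ∈ S.X i) → x ∉ D.XTglobal → a * δ ^ 2 ≤ D.totalStage x u := by
    intro x u hx hxT
    have : δ ≤ ‖x‖ := not_lt.1 fun h => hxT (hball x hx h)
    exact le_trans (by gcongr) (hstage x u)
  -- After `T₀` steps outside the terminal set the plan cost would be negative.
  obtain ⟨T₀, hT₀⟩ := exists_nat_gt (J / (a * δ ^ 2))
  set R := √(J / a') with hR
  have hR0 : 0 ≤ R := Real.sqrt_nonneg _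
  -- Until entry all states have norm at most `R`. The factor `γ ^ T₀` compensates for the missing
  -- decay during at most `T₀` steps, and `δ ≤ ‖x0‖` converts the absolute bound into a multiple of
  -- `‖x0‖`.
  refine ⟨C * R / (δ * γ ^ T₀), fun x0 u0 σ hx0 hσ hx0T hJ t => ?_⟩
  have hcl := fun t => hσ.cost_le hcoupling hterminal hcost hη hx0 hJ t
  have hx0X : ∀ i, x0 i ∈ S.X i := fun i => by
    obtain ⟨y, hy⟩ := hx0
    have := stateAt_mem_X hy (k := 0) (by lia) i
    rwa [stateAt_zero_of_feasible hy] at this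
  have hδx : δ ≤ ‖x0‖ := not_lt.1 fun h => hx0T (hball x0 hx0X h)
  have hex : ∃ T, (σ T).1 ∈ D.XTglobal := by
    by_contra hne
    push Not at hne
    obtain ⟨y, -, -, -, hc⟩ := hcl T₀ fun k _ => hne k
    have h0 : 0 ≤ ∑ i, D.cost i (y i) := Finset.sum_nonneg fun i _ => hcost.cost_nonneg i _
    rw [div_lt_iff₀ hη0] at hT₀
    linarith
  classical
  set T := Nat.find hex with hT
  have hTmem : (σ T).1 ∈ D.XTglobal := Nat.find_spec hex
  have hTmin : ∀ k < T, (σ k).1 ∉ D.XTglobal := fun k hk => Nat.find_min hex hk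
  have hTpos : 0 < T := by
    rw [Nat.pos_iff_ne_zero]
    intro h0
    rw [h0, hσ.1] at hTmem
    exact hx0T hTmem
  have hTle : T ≤ T₀ := by
    by_contra hgt
    obtain ⟨y, -, -, -, hc⟩ := hcl T₀ fun k hk => hTmin k (by lia)
    have h0 : 0 ≤ ∑ i, D.cost i (y i) := Finset.sum_nonneg fun i _ => hcost.cost_nonneg i _
    rw [div_lt_iff₀ hη0] at hT₀
    linarith
  have hpre : ∀ t < T, ‖(σ t).1‖ ≤ R ∧ ‖(σ (t + 1)).1‖ ≤ R := by
    intro t ht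
    obtain ⟨y, -, hy, h1, hc⟩ := hcl t fun k hk => hTmin k (by lia)
    have h2 : ‖D.ownInp y‖ ≤ R := by
      rw [hR]
      refine Real.le_sqrt_of_sq_le ?_
      rw [le_div_iff₀ ha']
      have : 0 ≤ (t : ℝ) * (a * δ ^ 2) := by positivity
      linarith [hown y]
    constructor
    · rw [← stateAt_zero_of_feasible hy]
      exact (norm_stateAt_le y 0).trans h2
    · have h3 := stateAt_succ_of_feasible hy D.N_pos
      rw [stateAt_zero_of_feasible hy, ← h1] at h3
      rw [← h3]
      exact (norm_stateAt_le y _).trans h2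
  have hscale : ∀ v : ℝ, v * γ ^ T₀ ≤ C * R * γ ^ t → v ≤ C * R / (δ * γ ^ T₀) * γ ^ t * ‖x0‖ := by
    intro v hv
    have h1 : C * R / (δ * γ ^ T₀) * γ ^ t * δ = C * R * γ ^ t / γ ^ T₀ := by
      field_simp
    refine le_trans ?_ (mul_le_mul_of_nonneg_left hδx (by positivity))
    rw [h1, le_div_iff₀ (by positivity)]
    exact hv
  apply hscale
  rcases lt_or_ge t T with ht | ht
  · have h1 := (hpre t ht).1
    have h2 : γ ^ T₀ ≤ γ ^ t := pow_le_pow_of_le_one hγ0.le hγ1.le (by lia)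
    calc ‖(σ t).1‖ * γ ^ T₀ ≤ R * γ ^ t := by gcongr
      _ ≤ C * R * γ ^ t := by
        gcongr
        exact le_mul_of_one_le_left hR0 hC
  · obtain ⟨d, rfl⟩ := Nat.exists_eq_add_of_le ht
    have h1 := hdecay u0 σ hσ.2 T hTmem d
    have h2 : ‖(σ T).1‖ ≤ R := by
      have := (hpre (T - 1) (by lia)).2
      rwa [Nat.sub_add_cancel hTpos] at this
    have h3 : γ ^ T₀ ≤ γ ^ T := pow_le_pow_of_le_one hγ0.le hγ1.le hTle
    calc ‖(σ (T + d)).1‖ * γ ^ T₀ ≤ (C * γ ^ d * R) * γ ^ T := by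
          gcongr
          exact h1.trans (by gcongr)
      _ = C * R * γ ^ (T + d) := by ring

/-- The plans have uniformly bounded cost if the constraint sets are bounded. -/
theorem exists_cost_le_of_isBounded (hX : ∀ i, Bornology.IsBounded (S.X i))
    (hU : ∀ i, Bornology.IsBounded (S.U i)) :
    ∃ J : ℝ, ∀ x, ∀ y ∈ D.feasible x, ∑ i, D.cost i (y i) ≤ J := by
  have hXi : ∀ i, ∃ r, ∀ v ∈ S.X i, ‖v‖ ≤ r := fun i => (hX i).exists_norm_le
  have hUi : ∀ i, ∃ r, ∀ v ∈ S.U i, ‖v‖ ≤ r := fun i => (hU i).exists_norm_le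
  choose rX hrX using hXi
  choose rU hrU using hUi
  -- One radius for all subsystems; absolute values guard against negative bounds chosen for empty
  -- sets.
  set r := ∑ i, (|rX i| + |rU i|) with hr
  have hle : ∀ i, |rX i| + |rU i| ≤ r := fun i =>
    Finset.single_le_sum (f := fun i => |rX i| + |rU i|) (fun _ _ => by positivity)
      (Finset.mem_univ i)
  have hr0 : 0 ≤ r := Finset.sum_nonneg fun _ _ => by positivity
  have hXr : ∀ i, ∀ v ∈ S.X i, ‖v‖ ≤ r := fun i v hv => by
    linarith [hrX i v hv, hle i, le_abs_self (rX i), abs_nonneg (rU i)]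
  have hUr : ∀ i, ∀ v ∈ S.U i, ‖v‖ ≤ r := fun i v hv => by
    linarith [hrU i v hv, hle i, le_abs_self (rU i), abs_nonneg (rX i)]
  have hcont : Continuous fun y : D.Var => ∑ i, D.cost i (y i) :=
    continuous_finsetSum _ fun i _ => (D.continuous_cost i).comp (continuous_apply i)
  obtain ⟨J, hJ⟩ := (isCompact_closedBall (0 : D.Var) r).bddAbove_image hcont.continuousOn
  refine ⟨J, fun x y hy => hJ ⟨y, ?_, rfl⟩⟩
  have hown : ∀ i, ‖LocVar.own (y i)‖ ≤ r := fun i =>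
    (pi_norm_le_iff_of_nonneg hr0).2 fun k => hXr i _ ((hy.1 i).2.1 k)
  rw [mem_closedBall_zero_iff, pi_norm_le_iff_of_nonneg hr0]
  intro i
  refine max_le (max_le (hown i) ((pi_norm_le_iff_of_nonneg hr0).2 fun j => ?_)) ?_
  · have := hy.2.2 i j
    unfold LocVar.copy at this
    rw [this]
    exact hown j
  · exact (pi_norm_le_iff_of_nonneg hr0).2 fun k => hUr i _ ((hy.1 i).2.2.1 k)

/-- The rate is always that of the terminal phase. Near the origin trajectories start in the
terminal set; elsewhere the constant comes from a bound on the first plan's cost: its own cost in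
general, a uniform bound when the constraint sets are bounded. -/
theorem exponentiallyStabilizing (hcoupling : D.CouplingAssumption)
    (hterminal : D.TerminalAssumption) (hcost : D.CostAssumption) :
    D.ExponentiallyStabilizing := by
  obtain ⟨γ, hγ0, hγ1, C, hC, hdecay⟩ := exists_terminal_decay hterminal hcost
  obtain ⟨δ, hδ, hball⟩ := hterminal.exists_ball_subset
  have hT : ∀ x0 u0 σ, D.IsClosedLoop x0 u0 σ → x0 ∈ D.XTglobal →
      ∀ t, ‖(σ t).1‖ ≤ C * γ ^ t * ‖x0‖ := by
    intro x0 u0 σ hσ hx t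
    have := hdecay u0 σ hσ.2 0 (by rw [hσ.1]; exact hx) t
    rwa [zero_add, hσ.1] at this
  refine ⟨γ, hγ0, hγ1, ⟨δ, hδ, C, ?_⟩, ?_, ?_⟩
  · intro x0 u0 σ hi hσ hn
    refine hT x0 u0 σ hσ (hball x0 (fun i => ?_) hn)
    obtain ⟨y, hy⟩ := hi.1
    have := stateAt_mem_X hy (k := 0) (by lia) i
    rwa [stateAt_zero_of_feasible hy] at this
  · intro x0 u0 σ hi hσ
    by_cases hx : x0 ∈ D.XTglobal
    · exact ⟨C, hT x0 u0 σ hσ hx⟩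
    -- The bound is the cost of this trajectory's first plan; the default 0 is irrelevant, because
    -- the first step is in MPC mode and stores a plan.
    · obtain ⟨C', hC'⟩ := exists_decay_of_cost_le hcoupling hterminal hcost hγ0 hγ1 hC hdecay
        ((σ 1).2.elim 0 fun y => ∑ i, D.cost i (y i))
      exact ⟨C', hC' x0 u0 σ hi.1 hσ hx fun y hy => by rw [hy]; exact le_rfl⟩
  · intro hX hU
    obtain ⟨J, hJ⟩ := exists_cost_le_of_isBounded (D := D) hX hU
    obtain ⟨C', hC'⟩ := exists_decay_of_cost_le hcoupling hterminal hcost hγ0 hγ1 hC hdecay J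
    refine ⟨max C C', fun x0 u0 σ hi hσ t => ?_⟩
    have hmono : ∀ c ≤ max C C', c * γ ^ t * ‖x0‖ ≤ max C C' * γ ^ t * ‖x0‖ := fun c hc => by
      gcongr
    by_cases hx : x0 ∈ D.XTglobal
    · exact (hT x0 u0 σ hσ hx t).trans (hmono _ (le_max_left _ _))
    · refine (hC' x0 u0 σ hi.1 hσ hx (fun y hy => ?_) t).trans (hmono _ (le_max_right _ _))
      obtain ⟨u, y', -, h2, hy', -⟩ := (hσ.2 0).mpc hcoupling hterminal hcost
        (by rw [hσ.1]; exact hx) (by rw [hσ.1]; exact hi.1)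
      rw [zero_add, hy, Option.some.injEq] at h2
      rw [h2]
      exact hJ _ _ hy'

end MPCDesign

end

noncomputable section

/-! ### Polyhedral preimages under linear and affine maps. -/

theorem IsPolyhedral.preimage_add {V W : Type*} [AddCommGroup V] [Module ℝ V] [AddCommGroup W]
    [Module ℝ W] {C : Set W} (h : IsPolyhedral C) (L : V →ₗ[ℝ] W) (c : W) :
    IsPolyhedral {y | L y + c ∈ C} :=
  h.preimage (L.toAffineMap + AffineMap.const ℝ V c)

theorem IsPolyhedral.preimage_linear {V W : Type*} [AddCommGroup V] [Module ℝ V] [AddCommGroup W]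
    [Module ℝ W] {C : Set W} (h : IsPolyhedral C) (L : V →ₗ[ℝ] W) : IsPolyhedral {y | L y ∈ C} :=
  h.preimage L.toAffineMap

namespace MPCDesign

variable {M : ℕ} {S : PWANetwork M} {D : MPCDesign S}

/-! ### Saddle points -/

/-- The switching sequence places every state in one polyhedral region and makes the dynamics
affine. The constraint by the union of the regions is then implied and can be omitted. -/
theorem isPolyhedral_localSet_inter_switchSet (hU : ∀ i, IsPolyhedron (S.U i))
    (hXT : ∀ i, IsPolyhedron (D.XT i)) (i : Fin M) (xi : S.St i) (s : D.SwSeq i) :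
    IsPolyhedral (D.localSet i xi ∩ D.switchSet i s) := by
  have h1 : ∀ k, IsPolyhedral {y : D.LocVar i |
      S.h i (LocVar.own y k) (fun j => LocVar.copy y j k) ≤ 0} := by
    intro k
    convert isPolyhedral_pi_nonpos.preimage_add ((S.H i).mulVecLin ∘ₗ D.ownMap i k
      + ∑ j, (S.Hc i j).mulVecLin ∘ₗ D.copyMap i j k) (S.h0 i) using 1
    ext y
    simp [PWANetwork.h, LinearMap.sum_apply]
  have h2 : ∀ k : Fin D.N, IsPolyhedral {y : D.LocVar i | LocVar.own y k.succ =
      S.aff i (s k.castSucc) (LocVar.own y k.castSucc) (LocVar.inp y k)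
        (fun j => LocVar.copy y j k.castSucc)} := by
    intro k
    convert isPolyhedral_pi_zero.preimage_add (D.ownMap i k.succ
      - ((S.A i (s k.castSucc)).mulVecLin ∘ₗ D.ownMap i k.castSucc
        + (S.B i (s k.castSucc)).mulVecLin ∘ₗ D.inpMap i k
        + ∑ j, (S.Ac i (s k.castSucc) j).mulVecLin ∘ₗ D.copyMap i j k.castSucc))
      (-S.c i (s k.castSucc)) using 1
    ext y
    simp only [Set.mem_ofPred_eq, PWANetwork.aff, LinearMap.sub_apply, LinearMap.add_apply,
      LinearMap.sum_apply, LinearMap.comp_apply, ownMap_apply, inpMap_apply, copyMap_apply,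
      mulVecLin_apply]
    rw [← sub_eq_zero]
    refine Eq.congr ?_ rfl
    abel
  have h3 : IsPolyhedral {y : D.LocVar i | LocVar.own y 0 = xi} := by
    convert isPolyhedral_pi_zero.preimage_add (D.ownMap i 0) (-xi) using 1
    ext y
    simp [← sub_eq_add_neg, sub_eq_zero]
  have h4 : ∀ k, IsPolyhedral {y : D.LocVar i | LocVar.inp y k ∈ S.U i} := fun k =>
    (hU i).isPolyhedral.preimage_linear (D.inpMap i k)
  have h5 : IsPolyhedral {y : D.LocVar i | LocVar.own y (Fin.last D.N) ∈ D.XT i} :=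
    (hXT i).isPolyhedral.preimage_linear (D.ownMap i (Fin.last D.N))
  have h6 : ∀ k, IsPolyhedral {y : D.LocVar i | LocVar.own y k ∈ S.P i (s k)} := fun k =>
    (S.isPolyhedron_P i (s k)).isPolyhedral.preimage_linear (D.ownMap i k)
  convert (IsPolyhedral.iInter h1).inter ((IsPolyhedral.iInter h2).inter (h3.inter
    ((IsPolyhedral.iInter h4).inter (h5.inter (IsPolyhedral.iInter h6))))) using 1
  ext y
  simp only [localSet, switchSet, Set.mem_inter_iff, Set.mem_ofPred_eq]
  constructor
  · rintro ⟨⟨a1, -, a3, a4, a5⟩, a6, a7⟩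
    exact ⟨a1, a6, a4, a3, a5, a7⟩
  · rintro ⟨a1, a6, a4, a3, a5, a7⟩
    refine ⟨⟨a1, fun k => ?_, a3, a4, a5⟩, a6, a7⟩
    rw [← S.iUnion_P i]
    exact Set.mem_iUnion.2 ⟨_, a7 k⟩

theorem isPolyhedral_localSets (hU : ∀ i, IsPolyhedron (S.U i))
    (hXT : ∀ i, IsPolyhedron (D.XT i)) (x : S.State) (s : ∀ i, D.SwSeq i) :
    IsPolyhedral {y : D.Var | ∀ i, y i ∈ D.localSet i (x i) ∩ D.switchSet i (s i)} :=
  IsPolyhedral.iInter (C := fun i => {y : D.Var | y i ∈ D.localSet i (x i) ∩ D.switchSet i (s i)})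
    fun i => (isPolyhedral_localSet_inter_switchSet hU hXT i (x i) (s i)).preimage_linear
      (LinearMap.proj i : D.Var →ₗ[ℝ] D.LocVar i)

/-- The cost need not be coercive in the copies, but on consistent points they repeat states it does
control. This gives existence of a minimizer of the global problem. -/
theorem Consistent.norm_le_ownInp {y : D.Var} (h : D.Consistent y) : ‖y‖ ≤ ‖D.ownInp y‖ := by
  have hi := fun i => norm_le_pi_norm (D.ownInp y) i
  have hown : ∀ i, ‖LocVar.own (y i)‖ ≤ ‖D.ownInp y‖ := fun i =>
    (norm_fst_le (D.ownInp y i)).trans (hi i)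
  rw [pi_norm_le_iff_of_nonneg (norm_nonneg _)]
  intro i
  refine max_le (max_le (hown i) ((pi_norm_le_iff_of_nonneg (norm_nonneg _)).2 fun j => ?_)) ?_
  · have := h i j
    unfold LocVar.copy at this
    rw [this]
    exact hown j
  · exact (norm_snd_le (D.ownInp y i)).trans (hi i)

theorem isClosed_feasibleSw (hterminal : D.TerminalAssumption) (s : ∀ i, D.SwSeq i)
    (x : S.State) : IsClosed (D.feasibleSw s x) := by
  refine isClosed_setOf_and (isClosed_setOf_forall fun i => ?_)
    (isClosed_setOf_forall fun i => isClosed_setOf_forall fun j => ?_)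
  · exact ((isClosed_localSet hterminal i (x i)).inter (isClosed_switchSet i _)).preimage
      (continuous_apply i)
  · unfold LocVar.copy LocVar.own
    exact isClosed_eq (by fun_prop) (by fun_prop)

variable (D) in
theorem augForm_nondegenerate : D.augForm.Nondegenerate := by
  have h : ∀ a, (∀ b, D.augForm a b = 0) → a = 0 := fun a ha =>
    D.eq_zero_of_augForm_self (ha a).le
  exact ⟨h, fun a ha => h a fun b => by rw [D.augForm_comm]; exact ha b⟩

/-- The convex problem for a fixed switching sequence has a saddle point. -/
theorem exists_saddle (hterminal : D.TerminalAssumption) (hcost : D.CostAssumption)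
    (hU : ∀ i, IsPolyhedron (S.U i)) (hXT : ∀ i, IsPolyhedron (D.XT i)) {x : S.State}
    {s : ∀ i, D.SwSeq i} (hne : (D.feasibleSw s x).Nonempty) :
    ∃ y₀ ∈ D.feasibleSw s x, ∃ lam₀, (∀ w ∈ D.consensus, D.augForm lam₀ w = 0) ∧
      ∀ y : D.Var, (∀ i, y i ∈ D.localSet i (x i) ∩ D.switchSet i (s i)) →
        0 ≤ 2 * D.totalForm y₀ (y - y₀) + D.augForm lam₀ (D.augMap (y - y₀)) := by
  have hpoly := isPolyhedral_localSets hU hXT x s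
  set C := {y : D.Var | ∀ i, y i ∈ D.localSet i (x i) ∩ D.switchSet i (s i)} with hC
  set L := D.consensus.comap D.augMap with hL
  have hset : D.feasibleSw s x = C ∩ L := by
    ext y
    simp only [feasibleSw, Set.mem_inter_iff, SetLike.mem_coe, hL, Submodule.mem_comap,
      augMap_mem_consensus_iff]
    rfl
  obtain ⟨a, ha, hown⟩ := hcost.exists_mul_norm_ownInp_le
  obtain ⟨y₀, hy₀, hmin⟩ := exists_isMinOn_of_quadratic_growth
    (isClosed_feasibleSw hterminal s x) hne
    (continuous_finsetSum _ fun i _ => (D.continuous_cost i).comp (continuous_apply i) :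
      Continuous fun y : D.Var => ∑ i, D.cost i (y i)) (c := 0) ha 0 (fun y hy => by
        rw [sub_zero, add_zero]
        refine le_trans ?_ (hown y)
        have := Consistent.norm_le_ownInp hy.2
        gcongr)
  have hy₀' := hy₀
  rw [hset] at hy₀' hmin
  -- Optimality for the plain cost: the variational inequality with penalty and multiplier set to
  -- zero.
  have hVI : ∀ y ∈ C, y - y₀ ∈ L → 0 ≤ ((2 : ℝ) • D.totalForm y₀) (y - y₀) := by
    intro y hy hyL
    have h1 := IsMinOn.variational_inequality (y := y) hcost.totalForm_comm D.augForm_comm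
      (T := D.augMap) (hpoly.convex.inter L.convex) (ρ := 0) (lam := 0) (z := 0) hy₀'
      (by simpa only [D.totalForm_self, map_zero, LinearMap.zero_apply, zero_div, zero_mul,
        add_zero] using hmin)
      ⟨hy, by simpa using L.add_mem hyL hy₀'.2⟩
    simpa using h1
  obtain ⟨ν, hν, hsad⟩ := hpoly.exists_multiplier L _ hy₀'.1 hVI
  -- A right inverse of `D.augMap`. Since `ν` vanishes on `L`, which contains the kernel of
  -- `D.augMap`, it factors through that map and is then represented by a vector `lam₀`.
  let sect : (∀ i, D.Aug i) →ₗ[ℝ] D.Var :=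
    LinearMap.pi fun i => LinearMap.inl ℝ _ _ ∘ₗ LinearMap.proj i
  have hsect : ∀ b, D.augMap (sect b) = b := fun b => rfl
  have hfac : ∀ y, ν (sect (D.augMap y)) = ν y := by
    intro y
    have : ν (y - sect (D.augMap y)) = 0 := hν _ (by
      rw [hL, Submodule.mem_comap, map_sub, hsect, sub_self]
      exact Submodule.zero_mem _)
    rw [map_sub, sub_eq_zero] at this
    exact this.symm
  obtain ⟨lam₀, hrep⟩ : ∃ lam₀, ∀ b, D.augForm lam₀ b = ν (sect b) :=
    ⟨(D.augForm.toDual D.augForm_nondegenerate).symm (ν ∘ₗ sect), fun b => by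
      rw [LinearMap.BilinForm.apply_toDual_symm_apply]
      rfl⟩
  refine ⟨y₀, hy₀, lam₀, fun w hw => ?_, fun y hy => ?_⟩
  · rw [hrep]
    exact hν _ (by rw [hL, Submodule.mem_comap, hsect]; exact hw)
  · rw [hrep, hfac]
    simpa using hsad y hy

/-! ### Convergence of switching ADMM -/

variable {x : S.State} {u : ∀ i, D.InpSeq i} {s : ℕ → ∀ i, D.SwSeq i} {y : ℕ → D.Var}
  {z : ℕ → ∀ i, D.Traj i} {lam : ℕ → ∀ i, D.Aug i}

theorem tendsto_zero_of_mul_sq_norm_le {E : Type*} [NormedAddCommGroup E] {v : ℕ → E} {q : ℕ → ℝ}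
    {a : ℝ} (ha : 0 < a) (h : ∀ τ, a * ‖v τ‖ ^ 2 ≤ q τ) (hq : Tendsto q atTop (𝓝 0)) :
    Tendsto v atTop (𝓝 0) := by
  rw [tendsto_zero_iff_norm_tendsto_zero]
  have h1 : Tendsto (fun τ => √(a⁻¹ * q τ)) atTop (𝓝 0) := by
    have := (hq.const_mul a⁻¹).sqrt
    rwa [mul_zero, Real.sqrt_zero] at this
  refine squeeze_zero (fun τ => norm_nonneg _) (fun τ => Real.le_sqrt_of_sq_le ?_) h1
  rw [le_inv_mul_iff₀ ha]
  exact h τ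

/-- From iteration `D.Tcut` on the run is ordinary ADMM for a feasible convex problem with a saddle
point. Earlier iterations matter only through the starting multipliers, which are orthogonal to
consensus. -/
theorem IsSwADMM.exists_tendsto (hcoupling : D.CouplingAssumption)
    (hterminal : D.TerminalAssumption) (hcost : D.CostAssumption)
    (hU : ∀ i, IsPolyhedron (S.U i)) (hXT : ∀ i, IsPolyhedron (D.XT i)) (hx : x ∈ D.X0)
    (h : D.IsSwADMM x u s y z lam) : ∃ y', Tendsto y atTop (𝓝 y') := by
  have hmem : ∀ τ i, y (D.Tcut + τ) i ∈ D.localSet i (x i) ∩ D.switchSet i (s D.Tcut i) := by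
    intro τ i
    have := h.y_mem (D.Tcut + τ) i
    rwa [h.switch_eq] at this
  obtain ⟨y₀, hy₀, lam₀, hlam₀, hsaddle⟩ := exists_saddle hterminal hcost hU hXT
    (hcoupling.nonempty hx fun i => ⟨_, hmem 0 i⟩)
  obtain ⟨hB, hG⟩ := admm_tendsto (y := fun τ => y (D.Tcut + τ))
    (z := fun τ => D.augOfMap (z (D.Tcut + τ))) (lam := fun τ => lam (D.Tcut + τ))
    hcost.totalForm_comm hcost.totalForm_nonneg D.augForm_comm D.augForm_self_nonneg
    (isPolyhedral_localSets hU hXT x (s D.Tcut)).convex D.ρ_pos hy₀.1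
    ((D.augMap_mem_consensus_iff y₀).2 hy₀.2) hlam₀ hsaddle hmem
    (fun τ => by
      have := h.isMinOn_sum (D.Tcut + τ)
      rwa [h.switch_eq] at this)
    (fun τ => D.augOfMap_mem _) (fun τ => h.augForm_lam _) fun τ => h.lam_succ' (D.Tcut + τ)
  obtain ⟨a, ha, hown⟩ := hcost.exists_mul_norm_ownInp_le
  obtain ⟨b, hb, hres⟩ := exists_mul_sq_norm_le (q := fun v => D.augForm v v)
    (D.continuous_augForm.comp (continuous_id.prodMk continuous_id))
    (fun t v => by
      simp only [map_smul, LinearMap.smul_apply, smul_eq_mul]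
      ring)
    fun v hv => by
      by_contra hn
      exact hv (D.eq_zero_of_augForm_self (not_lt.1 hn))
  have hlim1 := tendsto_zero_of_mul_sq_norm_le ha
    (fun τ => (hown (y (D.Tcut + τ) - y₀)).trans_eq (D.totalForm_self _).symm) hB
  have hlim2 := tendsto_zero_of_mul_sq_norm_le hb
    (fun τ => hres (D.augMap (y (D.Tcut + τ)) - D.augOfMap (z (D.Tcut + (τ + 1))))) hG
  have hown_lim : ∀ i, Tendsto (fun τ => (y (D.Tcut + τ) i).1.1) atTop (𝓝 (y₀ i).1.1) := by
    intro i
    have h1 := ((continuous_fst.comp (continuous_apply i)).tendsto _).comp hlim1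
    have h2 : Tendsto (fun τ => (y (D.Tcut + τ) i).1.1 - (y₀ i).1.1) atTop (𝓝 0) := h1
    simpa using h2.add_const (y₀ i).1.1
  have hinp_lim : ∀ i, Tendsto (fun τ => (y (D.Tcut + τ) i).2) atTop (𝓝 (y₀ i).2) := by
    intro i
    have h1 := ((continuous_snd.comp (continuous_apply i)).tendsto _).comp hlim1
    have h2 : Tendsto (fun τ => (y (D.Tcut + τ) i).2 - (y₀ i).2) atTop (𝓝 0) := h1
    simpa using h2.add_const (y₀ i).2
  -- The vanishing residual carries convergence from a trajectory to its average, and from there to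
  -- the copies, on which the cost gives no control.
  have hz_lim : ∀ i, Tendsto (fun τ => z (D.Tcut + (τ + 1)) i) atTop (𝓝 (y₀ i).1.1) := by
    intro i
    have h1 := ((continuous_fst.comp (continuous_apply i)).tendsto _).comp hlim2
    have h2 : Tendsto (fun τ => (y (D.Tcut + τ) i).1.1 - z (D.Tcut + (τ + 1)) i) atTop (𝓝 0) := h1
    simpa using (hown_lim i).sub h2
  have hcopy_lim : ∀ i, ∀ j : S.nbr i,
      Tendsto (fun τ => (y (D.Tcut + τ) i).1.2 j) atTop (𝓝 (y₀ j).1.1) := by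
    intro i j
    have h1 := ((((continuous_apply j).comp continuous_snd).comp
      (continuous_apply i)).tendsto _).comp hlim2
    have h2 : Tendsto (fun τ => (y (D.Tcut + τ) i).1.2 j - z (D.Tcut + (τ + 1)) j) atTop
      (𝓝 0) := h1
    simpa using h2.add (hz_lim j)
  refine ⟨fun i => (((y₀ i).1.1, fun j => (y₀ j).1.1), (y₀ i).2), ?_⟩
  rw [← tendsto_add_atTop_iff_nat D.Tcut]
  simp only [add_comm _ D.Tcut]
  exact tendsto_pi_nhds.2 fun i =>
    ((hown_lim i).prodMk_nhds (tendsto_pi_nhds.2 fun j => hcopy_lim i j)).prodMk_nhds (hinp_lim i)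

/-! ### Existence of executions -/

/-- Trajectories of the true dynamics obey every switching sequence that they generate. -/
theorem mem_switchSet_of_mem_evalSwitching {i : Fin M} {xi : S.St i} {y : D.LocVar i}
    (h0 : LocVar.own y 0 = xi)
    (hdyn : ∀ k : Fin D.N, LocVar.own y k.succ = S.f i (LocVar.own y k.castSucc) (LocVar.inp y k)
      (fun j => LocVar.copy y j k.castSucc))
    {s : D.SwSeq i} (hs : s ∈ D.evalSwitching i xi y) : y ∈ D.switchSet i s := by
  obtain ⟨ξ, hξ0, hξP, hξ⟩ := hs
  have hP : ∀ k, ξ k ∈ S.P i (s k) := fun k => by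
    have := hξP k
    rwa [(S.isPolyhedron_P i _).isClosed.closure_eq] at this
  have he : ∀ k, LocVar.own y k = ξ k := by
    intro k
    induction k using Fin.induction with
    | zero => rw [h0, hξ0]
    | succ k ih => rw [hdyn, ih, hξ, aff_eq_f (hP _)]
  exact ⟨fun k => by rw [he, he, hξ], fun k => by rw [he]; exact hP k⟩

theorem dynamics_of_mem_switchSet {i : Fin M} {y : D.LocVar i} {s : D.SwSeq i}
    (hy : y ∈ D.switchSet i s) (k : Fin D.N) : LocVar.own y k.succ =
      S.f i (LocVar.own y k.castSucc) (LocVar.inp y k) (fun j => LocVar.copy y j k.castSucc) := by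
  rw [hy.1 k, aff_eq_f (hy.2 _)]

/-- A guess with feasible roll-out is weakly feasible. -/
theorem weaklyFeasible_of_rollout_mem (h : D.rollout x u ∈ D.feasible x) :
    D.WeaklyFeasible x u := by
  constructor
  · have hP : ∀ i k, ∃ l, LocVar.own (D.rollout x u i) k ∈ S.P i l := fun i k => by
      have := (h.1 i).2.1 k
      rwa [← S.iUnion_P i, Set.mem_iUnion] at this
    choose l hl using hP
    refine ⟨l, fun i => ⟨LocVar.own (D.rollout x u i), rfl, fun k => subset_closure (hl i k),
      fun k => ?_⟩⟩
    rw [aff_eq_f (hl i _)]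
    exact rollout_dynamics x u i k
  · intro s hs
    exact ⟨_, fun i => ⟨h.1 i, mem_switchSet_of_mem_evalSwitching rfl
      (rollout_dynamics x u i) (hs i)⟩, h.2.2⟩

/-- Switching ADMM can be executed from every weakly feasible guess. -/
theorem WeaklyFeasible.exists_isSwADMM (hterminal : D.TerminalAssumption)
    (hcost : D.CostAssumption) (h : D.WeaklyFeasible x u) :
    ∃ s y z lam, D.IsSwADMM x u s y z lam := by
  classical
  obtain ⟨⟨s₀, hs₀⟩, hne⟩ := h
  -- The invariant of the recursion: every local problem is feasible for the current sequences.
  let F (s : ∀ i, D.SwSeq i) : Prop := ∀ i, (D.localSet i (x i) ∩ D.switchSet i (s i)).Nonempty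
  have hF₀ : F s₀ := fun i => by
    obtain ⟨y, hy⟩ := hne s₀ hs₀
    exact ⟨y i, hy.1 i⟩
  have step : ∀ (τ : ℕ) (p : {s // F s} × (∀ i, D.Traj i) × (∀ i, D.Aug i)),
      ∃ (y : D.Var) (p' : {s // F s} × (∀ i, D.Traj i) × (∀ i, D.Aug i)),
        (∀ i, y i ∈ D.localSet i (x i) ∩ D.switchSet i (p.1.1 i)) ∧
        (∀ i, IsMinOn (D.localObj i (p.2.2 i) p.2.1)
          (D.localSet i (x i) ∩ D.switchSet i (p.1.1 i)) (y i)) ∧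
        (∀ i, p'.2.1 i = D.average y i) ∧
        (∀ i, p'.2.2 i = p.2.2 i + D.ρ • ((y i).1 - D.augOf p'.2.1 i)) ∧
        (τ < D.Tcut → ∀ i, (D.evalSwitching i (x i) (y i) \ {p.1.1 i}).Nonempty →
          p'.1.1 i ∈ D.evalSwitching i (x i) (y i) \ {p.1.1 i}) ∧
        (τ < D.Tcut → ∀ i, ¬ (D.evalSwitching i (x i) (y i) \ {p.1.1 i}).Nonempty →
          p'.1.1 i = p.1.1 i) ∧
        (D.Tcut ≤ τ → p'.1.1 = p.1.1) := by
    rintro τ ⟨⟨s, hs⟩, z, lam⟩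
    have hy : ∀ i, ∃ y ∈ D.localSet i (x i) ∩ D.switchSet i (s i),
        IsMinOn (D.localObj i (lam i) z) (D.localSet i (x i) ∩ D.switchSet i (s i)) y := by
      intro i
      obtain ⟨a, ha, w, c, hge⟩ := hcost.exists_localObj_ge i (lam i) z
      exact exists_isMinOn_of_quadratic_growth
        ((isClosed_localSet hterminal i (x i)).inter (isClosed_switchSet i (s i))) (hs i)
        (D.continuous_localObj i (lam i) z) ha w fun y _ => hge y
    choose y hy hmin using hy
    -- Any newly generated sequence is obeyed by the minimizer that generated it, so that minimizer
    -- witnesses feasibility of the next local problem.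
    let s' : ∀ i, D.SwSeq i := fun i =>
      if h : τ < D.Tcut ∧ (D.evalSwitching i (x i) (y i) \ {s i}).Nonempty then h.2.some else s i
    have hs' : F s' := by
      intro i
      refine ⟨y i, (hy i).1, ?_⟩
      simp only [s']
      split_ifs with hif
      · exact mem_switchSet_of_mem_evalSwitching (hy i).1.2.2.2.1
          (dynamics_of_mem_switchSet (hy i).2) hif.2.some_mem.1
      · exact (hy i).2
    refine ⟨y, ⟨⟨s', hs'⟩, D.average y,
      fun i => lam i + D.ρ • ((y i).1 - D.augOf (D.average y) i)⟩, hy, hmin, fun _ => rfl,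
      fun _ => rfl, fun hτ i hi => ?_, fun hτ i hi => ?_, fun hτ => funext fun i => ?_⟩
    · simp only [s', dif_pos (And.intro hτ hi)]
      exact hi.some_mem
    · simp [s', hi]
    · simp [s', not_lt.2 hτ]
  choose Y P' h1 h2 h3 h4 h5 h6 h7 using step
  let p : ℕ → {s // F s} × (∀ i, D.Traj i) × (∀ i, D.Aug i) := fun τ =>
    Nat.rec (⟨s₀, hF₀⟩, 0, 0) (fun τ p => P' τ p) τ
  exact ⟨fun τ => (p τ).1.1, fun τ => Y τ (p τ), fun τ => (p τ).2.1, fun τ => (p τ).2.2,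
    { z_zero := rfl
      lam_zero := rfl
      s_zero := hs₀
      y_mem := fun τ => h1 τ (p τ)
      y_min := fun τ => h2 τ (p τ)
      z_succ := fun τ => h3 τ (p τ)
      lam_succ := fun τ => h4 τ (p τ)
      s_switch := fun τ hτ => h5 τ (p τ) hτ
      s_keep := fun τ hτ => h6 τ (p τ) hτ
      s_frozen := fun τ hτ => h7 τ (p τ) hτ }⟩

/-! ### Well-posedness -/

/-- Every state at which ADMM is started lies in `D.X0`, so runs converge. They exist because the
first guess is weakly feasible by assumption, and later ones because the shifted plan has a feasible
roll-out. -/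
theorem wellPosed (hcoupling : D.CouplingAssumption) (hterminal : D.TerminalAssumption)
    (hcost : D.CostAssumption) (hU : ∀ i, IsPolyhedron (S.U i))
    (hXT : ∀ i, IsPolyhedron (D.XT i)) : D.WellPosed := by
  intro x0 u0 hinit σ hreach
  -- In the terminal set the stored plan may be outdated, but that set is invariant and the plan is
  -- never consulted again.
  have hinv : σ.1 ∈ D.XTglobal ∨ σ = (x0, none) ∨ Tracks σ := by
    induction hreach with
    | refl => exact Or.inr (Or.inl rfl)
    | tail _ hstep ih =>
      rename_i σ σ' _
      by_cases hσ : σ.1 ∈ D.XTglobal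
      · obtain ⟨l, hl, he⟩ := hstep.terminal hσ
        rw [he]
        exact Or.inl (hterminal.next_mem hσ hl)
      · have hX0 : σ.1 ∈ D.X0 := by
          rcases ih with h | rfl | h
          exacts [absurd h hσ, hinit.1, h.mem_X0 hterminal hcost]
        obtain ⟨u, y, -, h2, hy, h1, -⟩ := hstep.mpc hcoupling hterminal hcost hσ hX0
        exact Or.inr (Or.inr ⟨_, y, h2, hy, h1⟩)
  by_cases hσ : σ.1 ∈ D.XTglobal
  · refine ⟨?_, fun h => absurd hσ h⟩
    have hP : ∀ i, ∃ l, σ.1 i ∈ S.P i l := fun i => by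
      have := hterminal.subset_X i (hσ i)
      rwa [← S.iUnion_P i, Set.mem_iUnion] at this
    choose l hl using hP
    exact ⟨(S.next σ.1 (fun i => D.K i (l i) *ᵥ σ.1 i), σ.2), Or.inl ⟨hσ, rfl, l, hl, rfl⟩⟩
  have hX0 : σ.1 ∈ D.X0 := by
    rcases hinv with h | rfl | h
    exacts [absurd h hσ, hinit.1, h.mem_X0 hterminal hcost]
  have hguess : ∃ u, D.IsGuess u0 σ.2 u ∧ D.WeaklyFeasible σ.1 u := by
    rcases hinv with h | rfl | ⟨x, y, h2, hy, h1⟩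
    · exact absurd h hσ
    · exact ⟨u0, rfl, hinit.2 hσ⟩
    · obtain ⟨u, hu⟩ := exists_shiftedGuess hy
      refine ⟨u, by rw [h2]; exact hu, ?_⟩
      rw [h1]
      exact weaklyFeasible_of_rollout_mem (hu.rollout_feasible hterminal hcost hy).1
  refine ⟨?_, fun _ u _ s y z lam hrun =>
    hrun.exists_tendsto hcoupling hterminal hcost hU hXT hX0⟩
  obtain ⟨u, hu, hwf⟩ := hguess
  obtain ⟨s, y, z, lam, hrun⟩ := hwf.exists_isSwADMM hterminal hcost
  obtain ⟨y', hy'⟩ := hrun.exists_tendsto hcoupling hterminal hcost hU hXT hX0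
  obtain ⟨w, hw⟩ : ∃ w, D.IsPlan σ.1 u w := ⟨_, y', ⟨s, y, z, lam, hrun, hy'⟩, rfl⟩
  exact ⟨(S.next σ.1 (fun i => LocVar.inp (w i) ⟨0, D.N_pos⟩), some w),
    Or.inr ⟨hσ, u, w, hu, hw, rfl, rfl⟩⟩

end MPCDesign

end

/-! ### The main theorem. -/

theorem theorem2 {M : ℕ} (S : PWANetwork M) (D : MPCDesign S)
    (hcoupling : D.CouplingAssumption) (hsystem : D.SystemAssumption)
    (hterminal : D.TerminalAssumption) (hcost : D.CostAssumption) :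
    D.ExponentiallyStabilizing ∧
      ((∀ i, IsPolyhedron (S.U i)) → (∀ i, IsPolyhedron (D.XT i)) → D.WellPosed) :=
  ⟨MPCDesign.exponentiallyStabilizing hcoupling hterminal hcost,
    MPCDesign.wellPosed hcoupling hterminal hcost⟩
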